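/- Let $\mathbb K\in\{\mathbb R,\mathbb C\}$ and let $X$ be a $\mathbb K$-Banach space. Let $\mathcal L(X)$ be the Banach space of bounded linear operators on $X$, and let $\mathcal I(X)=\{Q\in\mathcal L(X)\setminus\{0,I\}: Q^2=Q\}$, with the norm topology. Let $\mathcal G(X)$ be the set of non-zero proper complemented subspaces of $X$ (for $\dim X\le 1$ these sets are empty), and write $F\perp E$ if $E,F\in\mathcal G(X)$ are complements of each other. Equip $\mathcal G(X)$ with the topology and the analytic atlas of the Grassmann manifold: for $E_0\perp F_0$ put $q_{E_0,F_0}(T)=(I+T)(E_0)$ for $T\in\mathcal L(E_0,F_0)$; a set is open if and only if its preimages under all the maps $q_{E_0,F_0}$ are open, and the charts are the maps $q_{E_0,F_0}^{-1}:\{E: E\perp F_0\}\to\mathcal L(E_0,F_0)$. Let $$\mathcal P=\{(E,F)\in\mathcal G(X)\times\mathcal G(X): F\perp E\}$$ with the topology $\mathcal T$ induced from $\mathcal G(X)\times\mathcal G(X)$, let $\kappa_1:\mathcal P\to\mathcal G(X)$ be $\kappa_1(E,F)=E$, and for $(E,F)\in\mathcal P$ let $Q_E^F\in\mathcal I(X)$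 be the idempotent with range $E$ and kernel $F$. Definition. An affine-Banach subspace of a Banach space is a translate of a closed linear subspace; the space $\mathcal A(A,A')$ of continuous affine maps between two of them has the analytic structure given by the coordinates $f\mapsto(f(a_0)-a_0',\ \text{linear part of } f)$, for $a_0\in A$, $a_0'\in A'$. Let $\Upsilon,\Omega$ be (Hausdorff) analytic $\mathbb K$-Banach manifolds, $\kappa:\Upsilon\to\Omega$ an analytic surjection, and let each fiber $\Upsilon_\omega=\kappa^{-1}(\omega)$ be identified, by a homeomorphism, with an affine-Banach subspace of a Banach space. Then $\kappa$ is a *locally trivial analytic affine-Banach bundle* if there are, for each $\omega_0\in\Omega$, an open neighborhood $V_{\omega_0}$ of $\omega_0$ and a bi-analytic bijection $\Theta_{\omega_0}:V_{\omega_0}\times\Upsilon_{\omega_0}\to\kappa^{-1}(V_{\omega_0})$ restricting, for each $\omega\in V_{\omega_0}$, to an affine map of $\{\omega\}\times\Upsilon_{\omega_0}$ onto $\Upsilon_\omega$, such that for all $\omega_1,\omega_2$ with $V_{\omega_1}\cap V_{\omega_2}\ne\emptyset$ the map $$V_{\omega_1}\cap V_{\omega_2}\to\mathcal A(\Upsilon_{\omega_1},\Upsilon_{\omega_2}),\qquad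 \omega\mapsto\bigl(x\mapsto \Pi_2(\Theta_{\omega_2}^{-1}(\Theta_{\omega_1}(\omega,x)))\bigr)$$ is well defined and analytic, where $\Pi_2$ is the projection onto the second coordinate. Theorem. The map $(E,F)\mapsto Q_E^F$ is a homeomorphism from $(\mathcal P,\mathcal T)$ onto $\mathcal I(X)$. Moreover there is an analytic $\mathbb K$-Banach manifold structure on $\mathcal P$, compatible with $\mathcal T$, for which $(E,F)\mapsto Q_E^F$ is an analytic immersion into $\mathcal L(X)$ (that is, analytic, with derivative at each point injective and with complemented range), and for which $\kappa_1:\mathcal P\to\mathcal G(X)$ is a locally trivial analytic affine-Banach bundle, where each fiber $\kappa_1^{-1}(E)$ is identified, by $(E,F)\mapsto Q_E^F$, with an affine-Banach subspace of $\mathcal L(X)$. -/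

import Mathlib

open Set Topology

universe u v

noncomputable section

/-! ### Analytic Banach manifolds, with model spaces that may vary from chart to chart -/

/-- A chart on `M` with values in a normed space over `𝕜`: a bijection between a subset `source`
of `M` and a subset `target` of the model space. Openness, continuity, completeness of the model
and analyticity of the coordinate changes are required in `IsBanachManifold`. -/
structure BanachChart (𝕜 : Type*) [RCLike 𝕜] (M : Type*) where
  Model : Type*
  [normedAddCommGroup : NormedAddCommGroup Model]
  [normedSpace : NormedSpace 𝕜 Model]
  toPartialEquiv : PartialEquiv M Model

attribute [instance] BanachChart.normedAddCommGroup BanachChart.normedSpace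

/-- `A` is an analytic atlas of the topological space `M`, which makes `M` a (Hausdorff) analytic
`𝕜`-Banach manifold whose topology is the given one. -/
structure IsBanachManifold {𝕜 : Type*} [RCLike 𝕜] {M : Type*} [TopologicalSpace M]
    (A : Set (BanachChart 𝕜 M)) : Prop where
  t2 : T2Space M
  complete : ∀ c ∈ A, CompleteSpace c.Model
  cover : ∀ x : M, ∃ c ∈ A, x ∈ c.toPartialEquiv.source
  isOpen_source : ∀ c ∈ A, IsOpen c.toPartialEquiv.source
  isOpen_target : ∀ c ∈ A, IsOpen c.toPartialEquiv.target
  continuousOn : ∀ c ∈ A, ContinuousOn c.toPartialEquiv c.toPartialEquiv.source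
  continuousOn_symm : ∀ c ∈ A, ContinuousOn c.toPartialEquiv.symm c.toPartialEquiv.target
  analytic : ∀ c ∈ A, ∀ d ∈ A,
    AnalyticOnNhd 𝕜 (fun z => d.toPartialEquiv (c.toPartialEquiv.symm z))
      (c.toPartialEquiv.symm.trans d.toPartialEquiv).source

/-- The map `f` is analytic on the open set `s`, with respect to atlases `A` and `B`. -/
def IsAnalyticOn {𝕜 : Type*} [RCLike 𝕜] {M N : Type*} [TopologicalSpace M] [TopologicalSpace N]
    (A : Set (BanachChart 𝕜 M)) (B : Set (BanachChart 𝕜 N)) (f : M → N) (s : Set M) : Prop :=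
  ContinuousOn f s ∧
    ∀ x ∈ s, ∀ c ∈ A, ∀ d ∈ B, x ∈ c.toPartialEquiv.source → f x ∈ d.toPartialEquiv.source →
      AnalyticAt 𝕜 (fun z => d.toPartialEquiv (f (c.toPartialEquiv.symm z))) (c.toPartialEquiv x)

/-- The standard atlas of a normed space, consisting of the identity map alone. -/
def vectorAtlas (𝕜 : Type*) [RCLike 𝕜] (Z : Type*) [NormedAddCommGroup Z] [NormedSpace 𝕜 Z] :
    Set (BanachChart 𝕜 Z) :=
  {⟨Z, PartialEquiv.refl Z⟩}

/-- The product of two atlases. -/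
def prodAtlas {𝕜 : Type*} [RCLike 𝕜] {M N : Type*}
    (A : Set (BanachChart 𝕜 M)) (B : Set (BanachChart 𝕜 N)) : Set (BanachChart 𝕜 (M × N)) :=
  {e | ∃ c ∈ A, ∃ d ∈ B, e = ⟨c.Model × d.Model, c.toPartialEquiv.prod d.toPartialEquiv⟩}

/-- `f` is an analytic immersion of the manifold `M` with atlas `A` in the Banach space `Y`: it is
analytic, and its derivative at each point is injective with complemented range. (As coordinate
changes are bi-analytic, it does not matter in which chart the derivative is taken.) -/
def IsAnalyticImmersion {𝕜 : Type*} [RCLike 𝕜] {M : Type*} [TopologicalSpace M]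
    {Y : Type*} [NormedAddCommGroup Y] [NormedSpace 𝕜 Y]
    (A : Set (BanachChart 𝕜 M)) (f : M → Y) : Prop :=
  IsAnalyticOn A (vectorAtlas 𝕜 Y) f univ ∧
    ∀ x : M, ∃ c ∈ A, x ∈ c.toPartialEquiv.source ∧
      Function.Injective
        (fderiv 𝕜 (fun z => f (c.toPartialEquiv.symm z)) (c.toPartialEquiv x)) ∧
      (LinearMap.range
        (fderiv 𝕜 (fun z => f (c.toPartialEquiv.symm z)) (c.toPartialEquiv x) :
          c.Model →ₗ[𝕜] Y)).ClosedComplemented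

/-! ### Affine-Banach subspaces -/

/-- An affine-Banach subspace of a Banach space: a translate of a closed linear subspace. -/
structure AffineBanachSubspace (𝕜 : Type*) [RCLike 𝕜] (Y : Type*) [NormedAddCommGroup Y]
    [NormedSpace 𝕜 Y] where
  space : AffineSubspace 𝕜 Y
  nonempty : Nonempty space
  isClosed : IsClosed (space : Set Y)

instance {𝕜 : Type*} [RCLike 𝕜] {Y : Type*} [NormedAddCommGroup Y] [NormedSpace 𝕜 Y]
    (S : AffineBanachSubspace 𝕜 Y) : Nonempty S.space := S.nonempty

/-- The standard atlas of an affine-Banach subspace `S`: the charts `a ↦ a - a₀`, for `a₀ ∈ S`,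
with values in the direction of `S`. -/
def affineAtlas {𝕜 : Type*} [RCLike 𝕜] {Y : Type*} [NormedAddCommGroup Y] [NormedSpace 𝕜 Y]
    (S : AffineBanachSubspace 𝕜 Y) : Set (BanachChart 𝕜 S.space) :=
  Set.range fun a₀ : S.space => ⟨S.space.direction, (Equiv.vaddConst a₀).symm.toPartialEquiv⟩

/-- The coordinate `f ↦ (f a₀ - b₀, linear part of f)` on the space of continuous affine maps from
`S` to `S'`, which identifies it with a Banach space and so defines its analytic structure. -/
def affineMapCoord {𝕜 : Type*} [RCLike 𝕜] {Y Y' : Type*} [NormedAddCommGroup Y]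
    [NormedSpace 𝕜 Y] [NormedAddCommGroup Y'] [NormedSpace 𝕜 Y']
    {S : AffineBanachSubspace 𝕜 Y} {S' : AffineBanachSubspace 𝕜 Y'} (a₀ : S.space) (b₀ : S'.space)
    (f : S.space →ᴬ[𝕜] S'.space) :
    S'.space.direction × (S.space.direction →L[𝕜] S'.space.direction) :=
  (f a₀ -ᵥ b₀, f.contLinear)

/-! ### Affine-Banach bundles -/

/-- Affine-Banach space structures on the fibers of `κ`: the fiber over `ω` is identified, by a
homeomorphism, with an affine-Banach subspace of `Y ω`. -/
structure AffineBanachFibers (𝕜 : Type*) [RCLike 𝕜] {Υ Ω : Type*} [TopologicalSpace Υ]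
    (Y : Ω → Type*) [∀ ω, NormedAddCommGroup (Y ω)] [∀ ω, NormedSpace 𝕜 (Y ω)] (κ : Υ → Ω) where
  fiber : ∀ ω, AffineBanachSubspace 𝕜 (Y ω)
  homeo : ∀ ω, (κ ⁻¹' {ω}) ≃ₜ (fiber ω).space

/-- With the atlases `A` on `Υ` and `B` on `Ω`, and the affine-Banach space structures `S` on the
fibers, `κ : Υ → Ω` is a locally trivial analytic affine-Banach bundle.

The local trivialization `Θ ω₀` is a bi-analytic map of `V ω₀ ×` (fiber over `ω₀`) onto
`κ ⁻¹' (V ω₀)` whose restriction to `{ω} ×` (fiber over `ω₀`) is an affine map to the fiber over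
`ω` (it is onto that fiber because `Θ ω₀` is onto `κ ⁻¹' (V ω₀)`). Fibers are written in terms of
the affine-Banach subspaces with which they are identified. -/
structure IsAnalyticAffineBanachBundle {𝕜 : Type*} [RCLike 𝕜] {Υ Ω : Type*}
    [TopologicalSpace Υ] [TopologicalSpace Ω]
    {Y : Ω → Type*} [∀ ω, NormedAddCommGroup (Y ω)] [∀ ω, NormedSpace 𝕜 (Y ω)]
    (A : Set (BanachChart 𝕜 Υ)) (B : Set (BanachChart 𝕜 Ω)) (κ : Υ → Ω)
    (S : AffineBanachFibers 𝕜 Y κ) : Prop where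
  total : IsBanachManifold A
  base : IsBanachManifold B
  surjective : Function.Surjective κ
  analytic : IsAnalyticOn A B κ univ
  complete : ∀ ω, CompleteSpace (Y ω)
  locallyTrivial :
    ∃ (V : Ω → Set Ω) (Θ : ∀ ω₀, OpenPartialHomeomorph (Ω × (S.fiber ω₀).space) Υ),
      (∀ ω₀, IsOpen (V ω₀) ∧ ω₀ ∈ V ω₀ ∧
        (Θ ω₀).source = V ω₀ ×ˢ univ ∧ (Θ ω₀).target = κ ⁻¹' (V ω₀) ∧
        IsAnalyticOn (prodAtlas B (affineAtlas (S.fiber ω₀))) A (Θ ω₀) (Θ ω₀).source ∧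
        IsAnalyticOn A (prodAtlas B (affineAtlas (S.fiber ω₀))) (Θ ω₀).symm (Θ ω₀).target ∧
        ∀ ω ∈ V ω₀, ∃ g : (S.fiber ω₀).space →ᵃ[𝕜] (S.fiber ω).space,
          ∀ a, Θ ω₀ (ω, a) = ((S.homeo ω).symm (g a) : Υ)) ∧
      ∀ ω₁ ω₂, ∃ φ : Ω → ((S.fiber ω₁).space →ᴬ[𝕜] (S.fiber ω₂).space),
        (∀ ω ∈ V ω₁ ∩ V ω₂, ∀ a, φ ω a = ((Θ ω₂).symm (Θ ω₁ (ω, a))).2) ∧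
        ∀ a₀ b₀, IsAnalyticOn B (vectorAtlas 𝕜 _) (fun ω => affineMapCoord a₀ b₀ (φ ω))
          (V ω₁ ∩ V ω₂)

/-! ### The Grassmann manifold -/

/-- The set `𝒢(X)` of non-zero proper complemented subspaces of `X`. -/
@[ext]
structure BanachGrassmannian (𝕜 : Type*) [RCLike 𝕜] (X : Type*) [NormedAddCommGroup X]
    [NormedSpace 𝕜 X] where
  toSubmodule : Submodule 𝕜 X
  closedComplemented : toSubmodule.ClosedComplemented
  ne_bot : toSubmodule ≠ ⊥
  ne_top : toSubmodule ≠ ⊤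

/-- The pairs `(E, F)` in `𝒢(X) × 𝒢(X)` such that `F` is a complement of `E`. -/
@[ext]
structure ComplementaryPair (𝕜 : Type*) [RCLike 𝕜] (X : Type*) [NormedAddCommGroup X]
    [NormedSpace 𝕜 X] where
  fst : BanachGrassmannian 𝕜 X
  snd : BanachGrassmannian 𝕜 X
  isCompl : IsCompl fst.toSubmodule snd.toSubmodule

section Grassmannian

variable {𝕜 : Type*} [RCLike 𝕜] {X : Type*} [NormedAddCommGroup X] [NormedSpace 𝕜 X]

namespace ComplementaryPair

theorem isTopCompl [CompleteSpace X] {E F : BanachGrassmannian 𝕜 X} (h : IsCompl E.toSubmodule F.toSubmodule) :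
    Submodule.IsTopCompl E.toSubmodule F.toSubmodule :=
  Submodule.isTopCompl_iff_isCompl_isClosed.2 ⟨h, E.closedComplemented.isClosed, F.closedComplemented.isClosed⟩

/-- The subspace `(I + T)(E)`, for `p = (E, F)` and `T : E → F`. -/
def graph (p : ComplementaryPair 𝕜 X) (T : p.fst.toSubmodule →L[𝕜] p.snd.toSubmodule) : Submodule 𝕜 X :=
  LinearMap.range (p.fst.toSubmodule.subtype + p.snd.toSubmodule.subtype ∘ₗ (T : p.fst.toSubmodule →ₗ[𝕜] p.snd.toSubmodule))

theorem mem_graph (p : ComplementaryPair 𝕜 X) (T : p.fst.toSubmodule →L[𝕜] p.snd.toSubmodule) (x : X) :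
    x ∈ p.graph T ↔ ∃ e : p.fst.toSubmodule, (e : X) + T e = x := by
  simp [graph]

theorem isCompl_graph (p : ComplementaryPair 𝕜 X) (T : p.fst.toSubmodule →L[𝕜] p.snd.toSubmodule) :
    IsCompl (p.graph T) p.snd.toSubmodule := by
  have hp : IsCompl p.fst.toSubmodule p.snd.toSubmodule := p.isCompl
  constructor
  · rw [Submodule.disjoint_def]
    intro x hx hF
    obtain ⟨e, rfl⟩ := (p.mem_graph T x).1 hx
    have he : (e : X) ∈ p.snd.toSubmodule := by simpa using p.snd.toSubmodule.sub_mem hF (T e).2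
    have h0 : e = 0 := Subtype.ext (Submodule.disjoint_def.1 hp.disjoint _ e.2 he)
    simp [h0]
  · rw [codisjoint_iff, Submodule.eq_top_iff']
    intro x
    have hx : x ∈ p.fst.toSubmodule ⊔ p.snd.toSubmodule := by rw [hp.sup_eq_top]; trivial
    obtain ⟨e, he, f, hf, rfl⟩ := Submodule.mem_sup.1 hx
    refine Submodule.mem_sup.2 ⟨e + T ⟨e, he⟩, (p.mem_graph T _).2 ⟨⟨e, he⟩, rfl⟩,
      f - T ⟨e, he⟩, p.snd.toSubmodule.sub_mem hf (T ⟨e, he⟩).2, by abel⟩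

theorem closedComplemented_graph [CompleteSpace X] (p : ComplementaryPair 𝕜 X)
    (T : p.fst.toSubmodule →L[𝕜] p.snd.toSubmodule) : (p.graph T).ClosedComplemented := by
  have hp : Submodule.IsTopCompl p.fst.toSubmodule p.snd.toSubmodule := isTopCompl p.isCompl
  let P := p.fst.toSubmodule.projectionOntoL p.snd.toSubmodule hp
  let f : X →L[𝕜] X := (p.fst.toSubmodule.subtypeL + p.snd.toSubmodule.subtypeL ∘L T) ∘L P
  refine ⟨f.codRestrict (p.graph T) fun x => (p.mem_graph T _).2 ⟨P x, rfl⟩, ?_⟩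
  rintro ⟨x, hx⟩
  obtain ⟨e, rfl⟩ := (p.mem_graph T x).1 hx
  have hP : P ((e : X) + T e) = e := by
    simp only [P, map_add, Submodule.projectionOntoL_apply_left,
      Submodule.projectionOntoL_apply_right, add_zero]
  apply Subtype.ext
  change ((P ((e : X) + T e) : X) + (T (P ((e : X) + T e)) : X)) = (e : X) + T e
  rw [hP]

/-- For `p = (E, F)`, the map `q_{E,F} : 𝓛(E, F) → 𝒢(X)`, `T ↦ (I + T)(E)`. -/
def graphMap [CompleteSpace X] (p : ComplementaryPair 𝕜 X) (T : p.fst.toSubmodule →L[𝕜] p.snd.toSubmodule) :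
    BanachGrassmannian 𝕜 X :=
  ⟨p.graph T, p.closedComplemented_graph T,
    fun h => p.snd.ne_top (by simpa [h] using (p.isCompl_graph T).sup_eq_top),
    fun h => p.snd.ne_bot (by simpa [h] using (p.isCompl_graph T).inf_eq_bot)⟩

/-- `q_{E,F}` is a bijection from `𝓛(E, F)` onto the set of complements of `F`. -/
theorem bijOn_graphMap [CompleteSpace X] (p : ComplementaryPair 𝕜 X) :
    BijOn p.graphMap univ {E | IsCompl E.toSubmodule p.snd.toSubmodule} := by
  have hp : IsCompl p.fst.toSubmodule p.snd.toSubmodule := p.isCompl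
  refine ⟨fun T _ => p.isCompl_graph T, ?_, ?_⟩
  · intro T _ T' _ h
    have h' : p.graph T = p.graph T' := congrArg BanachGrassmannian.toSubmodule h
    ext e
    have he : (e : X) + T e ∈ p.graph T' := h' ▸ (p.mem_graph T _).2 ⟨e, rfl⟩
    obtain ⟨e', he'⟩ := (p.mem_graph T' _).1 he
    have h1 : ((e' - e : p.fst.toSubmodule) : X) = ((T e - T' e' : p.snd.toSubmodule) : X) := by
      push_cast
      rw [sub_eq_sub_iff_add_eq_add, he', add_comm]
    have h2 : ((e' - e : p.fst.toSubmodule) : X) = 0 :=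
      Submodule.disjoint_def.1 hp.disjoint _ (e' - e).2 (h1 ▸ (T e - T' e').2)
    have h3 : e' = e := sub_eq_zero.1 (Subtype.ext h2)
    subst h3
    exact (add_left_cancel he').symm
  · intro E hE
    have hE : IsCompl E.toSubmodule p.snd.toSubmodule := hE
    let Q := E.toSubmodule.projectionL p.snd.toSubmodule (isTopCompl hE)
    have hmem : ∀ e : p.fst.toSubmodule, Q (e : X) - e ∈ p.snd.toSubmodule := by
      intro e
      rw [← Submodule.projectionL_apply_eq_zero_iff (isTopCompl hE), map_sub]
      have : Q (Q (e : X)) = Q e :=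
        (Submodule.projectionL_eq_self_iff (isTopCompl hE) _).2
          (Submodule.projectionL_apply_mem _ _)
      exact sub_eq_zero.2 this
    let T : p.fst.toSubmodule →L[𝕜] p.snd.toSubmodule :=
      (Q ∘L p.fst.toSubmodule.subtypeL - p.fst.toSubmodule.subtypeL).codRestrict p.snd.toSubmodule hmem
    have hT : ∀ e : p.fst.toSubmodule, (e : X) + T e = Q e := by
      intro e
      change (e : X) + (Q (e : X) - e) = Q e
      abel
    refine ⟨T, mem_univ _, BanachGrassmannian.ext ?_⟩
    change p.graph T = E.toSubmodule
    apply le_antisymm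
    · intro x hx
      obtain ⟨e, rfl⟩ := (p.mem_graph T x).1 hx
      rw [hT]
      exact Submodule.projectionL_apply_mem _ _
    · intro x hx
      have hx' : x ∈ p.fst.toSubmodule ⊔ p.snd.toSubmodule := by rw [hp.sup_eq_top]; trivial
      obtain ⟨e, he, f, hf, rfl⟩ := Submodule.mem_sup.1 hx'
      refine (p.mem_graph T _).2 ⟨⟨e, he⟩, ?_⟩
      rw [hT]
      have h1 : Q (e + f) = e + f := (Submodule.projectionL_eq_self_iff _ _).2 hx
      have h2 : Q f = 0 := (Submodule.projectionL_apply_eq_zero_iff _).2 hf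
      rw [map_add, h2, add_zero] at h1
      exact h1

end ComplementaryPair

open ComplementaryPair

variable [CompleteSpace X]

/-- The topology of `𝒢(X)`: a set is open if and only if its preimages under all the maps
`q_{E,F} : 𝓛(E, F) → 𝒢(X)` are open. -/
instance : TopologicalSpace (BanachGrassmannian 𝕜 X) :=
  ⨆ p : ComplementaryPair 𝕜 X, TopologicalSpace.coinduced p.graphMap inferInstance

/-- Pairs of complementary subspaces carry the topology induced from `𝒢(X) × 𝒢(X)`. -/
instance : TopologicalSpace (ComplementaryPair 𝕜 X) :=
  TopologicalSpace.induced (fun p => (p.fst, p.snd)) inferInstance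

variable (𝕜 X) in
/-- The standard atlas of the Grassmann manifold: the charts `p_{E,F} = q_{E,F}⁻¹`, from the set of
complements of `F` to `𝓛(E, F)`, for all pairs `(E, F)` of complementary subspaces. -/
def grassmannAtlas : Set (BanachChart 𝕜 (BanachGrassmannian 𝕜 X)) :=
  Set.range fun p : ComplementaryPair 𝕜 X =>
    ⟨p.fst.toSubmodule →L[𝕜] p.snd.toSubmodule, (p.bijOn_graphMap.toPartialEquiv p.graphMap univ _).symm⟩

end Grassmannian

/-! ### Idempotents -/

/-- The set `ℐ(X)` of idempotents in `𝓛(X)` other than `0` and `I`, with the norm topology. -/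
abbrev Idempotents (𝕜 : Type*) [RCLike 𝕜] (X : Type*) [NormedAddCommGroup X]
    [NormedSpace 𝕜 X] : Type _ :=
  {Q : X →L[𝕜] X // IsIdempotentElem Q ∧ Q ≠ 0 ∧ Q ≠ 1}

/-- The idempotent `Q_E^F` with range `E` and kernel `F`. -/
def ComplementaryPair.idempotent {𝕜 : Type*} [RCLike 𝕜] {X : Type*} [NormedAddCommGroup X]
    [NormedSpace 𝕜 X] [CompleteSpace X] (p : ComplementaryPair 𝕜 X) : Idempotents 𝕜 X :=
  ⟨p.fst.toSubmodule.projectionL p.snd.toSubmodule (isTopCompl p.isCompl), Submodule.isIdempotentElem_projectionL _, by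
    intro h
    apply p.fst.ne_bot
    rw [← Submodule.range_projectionL (isTopCompl p.isCompl)]
    change LinearMap.range ((p.fst.toSubmodule.projectionL p.snd.toSubmodule (isTopCompl p.isCompl)) : X →ₗ[𝕜] X) = ⊥
    rw [h]
    simp, by
    intro h
    apply p.snd.ne_bot
    rw [← Submodule.ker_projectionL (isTopCompl p.isCompl)]
    change LinearMap.ker ((p.fst.toSubmodule.projectionL p.snd.toSubmodule (isTopCompl p.isCompl)) : X →ₗ[𝕜] X) = ⊥
    rw [h]
    exact LinearMap.ker_id⟩

theorem ComplementaryPair.range_ker_idempotent {𝕜 : Type*} [RCLike 𝕜] {X : Type*}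
    [NormedAddCommGroup X] [NormedSpace 𝕜 X] [CompleteSpace X] (p : ComplementaryPair 𝕜 X) :
    LinearMap.range (p.idempotent.1 : X →ₗ[𝕜] X) = p.fst.toSubmodule ∧
      LinearMap.ker (p.idempotent.1 : X →ₗ[𝕜] X) = p.snd.toSubmodule :=
  ⟨Submodule.range_projectionL _, Submodule.ker_projectionL _⟩

end

/-!
For `p = (E, F)`, the complements of `F` are the graphs of the operators `T : E → F`, and
`T ↦ G_T`, the projection onto the graph of `T` along `F`, is an affine section of the idempotents
over them. A fiber is parametrized with the help of any of its points `P`: the affine map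
`A ↦ P A (1 - P) + P` retracts `𝓛(X)` onto the projections with the same range as `P`. Since all
the `G_T` have the kernel `F`, the retractions defined by `G_S` and `G_T` are inverse to each other
between the corresponding fibers. Hence `(T, A) ↦ G_T A (1 - G_T) + G_T` parametrizes the
idempotents whose range is a graph over `E`, analytically in `(T, A)` and affinely in `A`; it gives
the charts of the manifold of pairs as well as the local trivializations.

An idempotent `Q` close to `Q_E^F` has as range the image of `E` under `Q`, the graph of the slope
of `Q` restricted to `E`, an analytic function of the operator `Q`. So `T` and `A` are restrictions
of analytic functions on an open subset of `𝓛(X)`; hence `(E, F)` depends continuously on `Q_E^F`,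
and `(E, F) ↦ Q_E^F` is an immersion. Conversely, if `P` and `P'` are the projections onto graphs
close to `E` and `F` that have the kernels `F` and `E`, the idempotent `Q` with the range of `P` and
the range of `P'` as kernel satisfies `Q (P + P') = P`, where `P + P'` is close to `1`, so that `Q`
is a continuous function of its range and kernel.
-/

noncomputable section

section Manifold

variable {𝕜 : Type*} [RCLike 𝕜] {M N : Type*} [TopologicalSpace M] [TopologicalSpace N]
  {A : Set (BanachChart 𝕜 M)} {B : Set (BanachChart 𝕜 N)}

namespace IsBanachManifold

/-- A chart of a Banach manifold as a homeomorphism between open sets. -/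
def openPartialHomeomorph (hA : IsBanachManifold A) {c : BanachChart 𝕜 M} (hc : c ∈ A) :
    OpenPartialHomeomorph M c.Model where
  toPartialEquiv := c.toPartialEquiv
  open_source := hA.isOpen_source c hc
  open_target := hA.isOpen_target c hc
  continuousOn_toFun := hA.continuousOn c hc
  continuousOn_invFun := hA.continuousOn_symm c hc

theorem tendsto_symm (hA : IsBanachManifold A) {c : BanachChart 𝕜 M} (hc : c ∈ A) {x : M}
    (hx : x ∈ c.toPartialEquiv.source) :
    Filter.Tendsto c.toPartialEquiv.symm (𝓝 (c.toPartialEquiv x)) (𝓝 x) :=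
  (hA.openPartialHomeomorph hc).tendsto_symm hx

theorem eventually_mem_source (hA : IsBanachManifold A) {c : BanachChart 𝕜 M} (hc : c ∈ A) {x : M}
    (hx : x ∈ c.toPartialEquiv.source) : ∀ᶠ y in 𝓝 x, y ∈ c.toPartialEquiv.source :=
  (hA.isOpen_source c hc).mem_nhds hx

theorem analyticAt_coordChange (hA : IsBanachManifold A) {c d : BanachChart 𝕜 M} (hc : c ∈ A)
    (hd : d ∈ A) {x : M} (hxc : x ∈ c.toPartialEquiv.source) (hxd : x ∈ d.toPartialEquiv.source) :
    AnalyticAt 𝕜 (fun z => d.toPartialEquiv (c.toPartialEquiv.symm z)) (c.toPartialEquiv x) :=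
  hA.analytic c hc d hd _
    ⟨c.toPartialEquiv.map_source hxc, by simpa [c.toPartialEquiv.left_inv hxc] using hxd⟩

end IsBanachManifold

theorem IsAnalyticOn.of_exists_charts (hA : IsBanachManifold A) (hB : IsBanachManifold B)
    {f : M → N} {s : Set M} (hf : ∀ x ∈ s, ContinuousAt f x)
    (h : ∀ x ∈ s, ∃ c ∈ A, ∃ d ∈ B, x ∈ c.toPartialEquiv.source ∧ f x ∈ d.toPartialEquiv.source ∧
      AnalyticAt 𝕜 (fun z => d.toPartialEquiv (f (c.toPartialEquiv.symm z)))
        (c.toPartialEquiv x)) :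
    IsAnalyticOn A B f s := by
  refine ⟨fun x hx => (hf x hx).continuousWithinAt, fun x hx c' hc' d' hd' hxc' hxd' => ?_⟩
  obtain ⟨c, hc, d, hd, hxc, hxd, hfx⟩ := h x hx
  have hcx : c.toPartialEquiv (c'.toPartialEquiv.symm (c'.toPartialEquiv x)) =
      c.toPartialEquiv x := by rw [c'.toPartialEquiv.left_inv hxc']
  have hdx : d.toPartialEquiv (f (c.toPartialEquiv.symm (c.toPartialEquiv
      (c'.toPartialEquiv.symm (c'.toPartialEquiv x))))) = d.toPartialEquiv (f x) := by
    rw [hcx, c.toPartialEquiv.left_inv hxc]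
  have hfc : AnalyticAt 𝕜 (fun z => d.toPartialEquiv (f (c.toPartialEquiv.symm
      (c.toPartialEquiv (c'.toPartialEquiv.symm z))))) (c'.toPartialEquiv x) :=
    AnalyticAt.fun_comp (g := fun z => d.toPartialEquiv (f (c.toPartialEquiv.symm z)))
      (hcx ▸ hfx) (hA.analyticAt_coordChange hc' hc hxc' hxc)
  refine (AnalyticAt.fun_comp (hdx ▸ hB.analyticAt_coordChange hd hd' hxd hxd') hfc).congr ?_
  have hev : ∀ᶠ y in 𝓝 x, y ∈ c.toPartialEquiv.source ∧ f y ∈ d.toPartialEquiv.source :=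
    (hA.eventually_mem_source hc hxc).and
      ((hf x hx).eventually (hB.eventually_mem_source hd hxd))
  filter_upwards [(hA.tendsto_symm hc' hxc').eventually hev] with z hz
  rw [c.toPartialEquiv.left_inv hz.1, d.toPartialEquiv.left_inv hz.2]

theorem IsAnalyticOn.mono {f : M → N} {s t : Set M} (hf : IsAnalyticOn A B f s) (hts : t ⊆ s) :
    IsAnalyticOn A B f t :=
  ⟨hf.1.mono hts, fun x hx => hf.2 x (hts hx)⟩

theorem isAnalyticOn_chart_trans_symm (hA : IsBanachManifold A) (hB : IsBanachManifold B)
    {Z : Type*} [NormedAddCommGroup Z] [NormedSpace 𝕜 Z] {e : PartialEquiv M Z}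
    {e' : PartialEquiv N Z} (he : ⟨Z, e⟩ ∈ A) (he' : ⟨Z, e'⟩ ∈ B) :
    IsAnalyticOn A B (e.trans e'.symm) (e.trans e'.symm).source := by
  refine .of_exists_charts hA hB
    (fun x hx => ((hA.openPartialHomeomorph he).trans
      (hB.openPartialHomeomorph he').symm).continuousAt hx)
    fun x hx => ⟨_, he, _, he', hx.1, e'.map_target hx.2, ?_⟩
  refine analyticAt_id.congr ?_
  filter_upwards [(hA.isOpen_target _ he).mem_nhds (e.map_source hx.1),
    (hB.isOpen_target _ he').mem_nhds hx.2] with z hz hz'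
  simp only [id, PartialEquiv.coe_trans, Function.comp_apply, e.right_inv hz, e'.right_inv hz']

theorem isBanachManifold_vectorAtlas (Z : Type*) [NormedAddCommGroup Z] [NormedSpace 𝕜 Z]
    [hZ : CompleteSpace Z] : IsBanachManifold (vectorAtlas 𝕜 Z) where
  t2 := inferInstance
  complete := by rintro _ rfl; exact hZ
  cover x := ⟨_, rfl, mem_univ x⟩
  isOpen_source := by rintro _ rfl; exact isOpen_univ
  isOpen_target := by rintro _ rfl; exact isOpen_univ
  continuousOn := by rintro _ rfl; exact continuousOn_id
  continuousOn_symm := by rintro _ rfl; exact continuousOn_id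
  analytic := by rintro _ rfl _ rfl z _; exact analyticAt_id

theorem IsBanachManifold.prod (hA : IsBanachManifold A) (hB : IsBanachManifold B) :
    IsBanachManifold (prodAtlas A B) where
  t2 := by
    have := hA.t2
    have := hB.t2
    infer_instance
  complete := by
    rintro _ ⟨c, hc, d, hd, rfl⟩
    have := hA.complete c hc
    have := hB.complete d hd
    exact (inferInstance : CompleteSpace (c.Model × d.Model))
  cover := by
    rintro ⟨x, y⟩
    obtain ⟨c, hc, hx⟩ := hA.cover x
    obtain ⟨d, hd, hy⟩ := hB.cover y
    exact ⟨_, ⟨c, hc, d, hd, rfl⟩, ⟨hx, hy⟩⟩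
  isOpen_source := by
    rintro _ ⟨c, hc, d, hd, rfl⟩
    exact (hA.isOpen_source c hc).prod (hB.isOpen_source d hd)
  isOpen_target := by
    rintro _ ⟨c, hc, d, hd, rfl⟩
    exact (hA.isOpen_target c hc).prod (hB.isOpen_target d hd)
  continuousOn := by
    rintro _ ⟨c, hc, d, hd, rfl⟩
    exact (hA.continuousOn c hc).prodMap (hB.continuousOn d hd)
  continuousOn_symm := by
    rintro _ ⟨c, hc, d, hd, rfl⟩
    exact (hA.continuousOn_symm c hc).prodMap (hB.continuousOn_symm d hd)
  analytic := by
    rintro _ ⟨c, hc, d, hd, rfl⟩ _ ⟨c', hc', d', hd', rfl⟩ z ⟨hz, hz'⟩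
    exact ((hA.analytic c hc c' hc' z.1 ⟨hz.1, hz'.1⟩).fun_comp analyticAt_fst).prod
      ((hB.analytic d hd d' hd' z.2 ⟨hz.2, hz'.2⟩).fun_comp analyticAt_snd)

theorem isBanachManifold_affineAtlas {Y : Type*} [NormedAddCommGroup Y] [NormedSpace 𝕜 Y]
    [CompleteSpace Y] (S : AffineBanachSubspace 𝕜 Y) : IsBanachManifold (affineAtlas S) where
  t2 := inferInstance
  complete := by
    rintro _ ⟨a, rfl⟩
    exact ((AffineSubspace.isClosed_direction_iff S.space).2 S.isClosed).completeSpace_coe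
  cover x := ⟨_, ⟨x, rfl⟩, mem_univ _⟩
  isOpen_source := by rintro _ ⟨a, rfl⟩; exact isOpen_univ
  isOpen_target := by rintro _ ⟨a, rfl⟩; exact isOpen_univ
  continuousOn := by
    rintro _ ⟨a, rfl⟩
    exact (continuous_id.vsub continuous_const).continuousOn
  continuousOn_symm := by
    rintro _ ⟨a, rfl⟩
    exact (continuous_id.vadd continuous_const).continuousOn
  analytic := by
    rintro _ ⟨a, rfl⟩ _ ⟨b, rfl⟩ z _
    exact (analyticAt_id.add analyticAt_const).congr
      (.of_forall fun w => (vadd_vsub_assoc w a b).symm)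

end Manifold

section Calculus

variable {𝕜 : Type*} [NontriviallyNormedField 𝕜] {Y Z : Type*} [NormedAddCommGroup Y]
  [NormedSpace 𝕜 Y] [NormedAddCommGroup Z] [NormedSpace 𝕜 Z]

theorem leftInverse_fderiv {f : Y → Z} {g : Z → Y} {y : Y} (hf : DifferentiableAt 𝕜 f y)
    (hg : DifferentiableAt 𝕜 g (f y)) (h : g ∘ f =ᶠ[𝓝 y] id) :
    Function.LeftInverse (fderiv 𝕜 g (f y)) (fderiv 𝕜 f y) := by
  have hcomp : fderiv 𝕜 g (f y) ∘L fderiv 𝕜 f y = .id 𝕜 Y := by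
    rw [← fderiv_comp y hg hf, h.fderiv_eq, fderiv_id]
  exact DFunLike.congr_fun hcomp

theorem contDiff_mulLeftRight {R : Type*} [NormedRing R] [NormedAlgebra 𝕜 R] {f g : Y → R}
    {n : WithTop ℕ∞} (hf : ContDiff 𝕜 n f) (hg : ContDiff 𝕜 n g) :
    ContDiff 𝕜 n fun y => ContinuousLinearMap.mulLeftRight 𝕜 R (f y) (g y) :=
  ((ContinuousLinearMap.mul 𝕜 R).flip.contDiff.comp hg).clm_comp
    ((ContinuousLinearMap.mul 𝕜 R).contDiff.comp hf)

end Calculus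

section Projections

variable {𝕜 : Type*} [NontriviallyNormedField 𝕜] {X : Type*} [NormedAddCommGroup X]
  [NormedSpace 𝕜 X]

/-- The affine space of continuous projections of `X` onto `E`; it is empty if `E` is not
complemented. -/
def projectionsOnto (E : Submodule 𝕜 X) : AffineSubspace 𝕜 (X →L[𝕜] X) where
  carrier := {P | LinearMap.IsProj E P}
  smul_vsub_vadd_mem' c P₁ P₂ P₃ h₁ h₂ h₃ :=
    ⟨fun x => E.add_mem (E.smul_mem c (E.sub_mem (h₁.map_mem x) (h₂.map_mem x))) (h₃.map_mem x),
      fun x hx => by simp [h₁.map_id x hx, h₂.map_id x hx, h₃.map_id x hx]⟩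

namespace projectionsOnto

variable {E E' : Submodule 𝕜 X} {P Q : X →L[𝕜] X}

theorem range_eq (hP : P ∈ projectionsOnto E) : LinearMap.range (P : X →ₗ[𝕜] X) = E :=
  LinearMap.IsProj.range ⟨hP.map_mem, hP.map_id⟩

theorem mul_eq_right_iff (hP : P ∈ projectionsOnto E) (hQ : Q ∈ projectionsOnto E') :
    Q * P = P ↔ E ≤ E' := by
  refine ⟨fun h x hx => ?_, fun h => ContinuousLinearMap.ext fun x => ?_⟩
  · rw [← hP.map_id x hx, ← h]
    exact hQ.map_mem (P x)
  · exact hQ.map_id (P x) (h (hP.map_mem x))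

theorem mul_eq_right (hP : P ∈ projectionsOnto E) (hQ : Q ∈ projectionsOnto E) : Q * P = P :=
  (mul_eq_right_iff hP hQ).2 le_rfl

theorem mem_iff (hP : P ∈ projectionsOnto E) :
    Q ∈ projectionsOnto E ↔ P * Q = Q ∧ Q * P = P := by
  refine ⟨fun hQ => ⟨mul_eq_right hQ hP, mul_eq_right hP hQ⟩,
    fun h => ⟨fun x => ?_, fun x hx => ?_⟩⟩
  · rw [← h.1]
    exact hP.map_mem (Q x)
  · rw [← hP.map_id x hx]
    exact DFunLike.congr_fun h.2 x

theorem isClosed [Nonempty (projectionsOnto E)] :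
    IsClosed (projectionsOnto E : Set (X →L[𝕜] X)) := by
  obtain ⟨P, hP⟩ := ‹Nonempty (projectionsOnto E)›
  have heq : (projectionsOnto E : Set (X →L[𝕜] X)) = {Q | P * Q = Q} ∩ {Q | Q * P = P} :=
    Set.ext fun Q => mem_iff hP
  rw [heq]
  exact (isClosed_eq (continuous_const.mul continuous_id) continuous_id).inter
    (isClosed_eq (continuous_id.mul continuous_const) continuous_const)

end projectionsOnto

/-- The affine map `A ↦ P A (1 - P) + P`. If `P` is a projection onto `E`, it is a retraction of
the space of operators onto the space of projections onto `E`. -/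
def projectionRetraction (P : X →L[𝕜] X) : (X →L[𝕜] X) →ᴬ[𝕜] (X →L[𝕜] X) :=
  (ContinuousLinearMap.mulLeftRight 𝕜 (X →L[𝕜] X) P (1 - P)).toContinuousAffineMap +
    ContinuousAffineMap.const 𝕜 _ P

theorem projectionRetraction_apply (P A : X →L[𝕜] X) :
    projectionRetraction P A = P * A * (1 - P) + P := rfl

theorem contLinear_projectionRetraction (P : X →L[𝕜] X) : (projectionRetraction P).contLinear =
    ContinuousLinearMap.mulLeftRight 𝕜 (X →L[𝕜] X) P (1 - P) :=
  add_zero _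

theorem projectionRetraction_mem {E : Submodule 𝕜 X} {P : X →L[𝕜] X} (hP : P ∈ projectionsOnto E)
    (A : X →L[𝕜] X) : projectionRetraction P A ∈ projectionsOnto E where
  map_mem x := E.add_mem (hP.map_mem _) (hP.map_mem x)
  map_id x hx := by simp [projectionRetraction_apply, hP.map_id x hx]

theorem projectionRetraction_of_mem {E : Submodule 𝕜 X} {P Q : X →L[𝕜] X}
    (hP : P ∈ projectionsOnto E) (hQ : Q ∈ projectionsOnto E) : projectionRetraction P Q = Q := by
  rw [projectionRetraction_apply, projectionsOnto.mul_eq_right hQ hP, mul_sub, mul_one,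
    projectionsOnto.mul_eq_right hP hQ, sub_add_cancel]

theorem projectionRetraction_projectionRetraction {P Q : X →L[𝕜] X} (hPQ : P * Q = P)
    (hQP : Q * P = Q) (A : X →L[𝕜] X) :
    projectionRetraction P (projectionRetraction Q A) = projectionRetraction P A := by
  have hker : (1 - Q) * (1 - P) = 1 - P := by rw [mul_one_sub, sub_mul, hQP]; simp
  have hP : P * P = P := by
    calc P * P = P * (Q * P) := by rw [← mul_assoc, hPQ]
      _ = P := by rw [hQP, hPQ]
  calc P * (Q * A * (1 - Q) + Q) * (1 - P) + P
      = P * Q * A * ((1 - Q) * (1 - P)) + P * Q * (1 - P) + P := by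
        simp only [mul_add, add_mul, mul_assoc]
    _ = P * A * (1 - P) + P := by rw [hker, hPQ, mul_one_sub P P, hP, sub_self, add_zero]

variable {E : Submodule 𝕜 X} (P : projectionsOnto E)

namespace projectionsOnto

/-- The linear part of the affine retraction of the space of operators onto the space of
projections onto `E` that is defined by the projection `P`. -/
def compress : (X →L[𝕜] X) →L[𝕜] (projectionsOnto E).direction :=
  (ContinuousLinearMap.mulLeftRight 𝕜 (X →L[𝕜] X) P.1 (1 - P.1)).codRestrict _ fun A => by
    have h := AffineSubspace.vsub_mem_direction (projectionRetraction_mem P.2 A) P.2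
    rwa [vsub_eq_sub, projectionRetraction_apply, add_sub_cancel_right] at h

theorem coe_compress_add (A : X →L[𝕜] X) :
    (compress P A : X →L[𝕜] X) + P = projectionRetraction P.1 A := rfl

theorem compress_coe_add (D : (projectionsOnto E).direction) : compress P (D + P) = D := by
  have hmem : (D : X →L[𝕜] X) + P ∈ projectionsOnto E :=
    AffineSubspace.vadd_mem_of_mem_direction D.2 P.2
  refine Subtype.ext (add_right_cancel (b := (P : X →L[𝕜] X)) ?_)
  rw [coe_compress_add, projectionRetraction_of_mem P.2 hmem]

theorem compress_projectionRetraction {Q : X →L[𝕜] X} (hPQ : (P : X →L[𝕜] X) * Q = P)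
    (hQP : Q * P = Q) (A : X →L[𝕜] X) : compress P (projectionRetraction Q A) = compress P A := by
  apply Subtype.ext
  apply add_right_cancel (b := (P : X →L[𝕜] X))
  simp only [coe_compress_add]
  exact projectionRetraction_projectionRetraction hPQ hQP A

variable [Nonempty (projectionsOnto E)]

/-- The affine retraction of the space of operators onto the space of projections onto `E` that is
defined by the projection `P`. -/
def retract : (X →L[𝕜] X) →ᴬ[𝕜] projectionsOnto E where
  toFun A := compress P A +ᵥ P
  linear := (compress P).toLinearMap
  map_vadd' A B := by simp [vadd_vadd]
  cont := (compress P).continuous.fun_vadd continuous_const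

theorem contLinear_retract : (retract P).contLinear = compress P := rfl

end projectionsOnto
end Projections

section Grassmannian

variable {𝕜 : Type*} [RCLike 𝕜] {X : Type*} [NormedAddCommGroup X] [NormedSpace 𝕜 X]

namespace ComplementaryPair

/-- The space `𝓛(E, F)` of the slopes of the graphs over `E` along `F`, for `p = (E, F)`. -/
abbrev Slope (p : ComplementaryPair 𝕜 X) : Type _ := p.fst.toSubmodule →L[𝕜] p.snd.toSubmodule

variable (p : ComplementaryPair 𝕜 X)

/-- The embedding `e ↦ e + T e` of `E` onto the graph of `T`, for `p = (E, F)`. -/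
def graphEmb (T : p.Slope) : p.fst.toSubmodule →L[𝕜] X :=
  p.fst.toSubmodule.subtypeL + p.snd.toSubmodule.subtypeL ∘L T

theorem graphEmb_apply (T : p.Slope) (e : p.fst.toSubmodule) : p.graphEmb T e = e + T e := rfl

theorem range_graphEmb (T : p.Slope) :
    LinearMap.range (p.graphEmb T : p.fst.toSubmodule →ₗ[𝕜] X) = p.graph T := rfl

theorem contDiff_graphEmb {n : WithTop ℕ∞} : ContDiff 𝕜 n p.graphEmb :=
  contDiff_const.add (contDiff_const.clm_comp contDiff_id)

end ComplementaryPair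

variable [CompleteSpace X]

instance (E : BanachGrassmannian 𝕜 X) : CompleteSpace E.toSubmodule :=
  E.closedComplemented.isClosed.completeSpace_coe

/-- A pair of complementary subspaces with first member `E`. -/
def BanachGrassmannian.pair (E : BanachGrassmannian 𝕜 X) : ComplementaryPair 𝕜 X where
  fst := E
  snd := ⟨E.closedComplemented.complement,
    E.closedComplemented.isTopCompl_complement.symm.closedComplemented,
    fun h => E.ne_top (by simpa [h] using E.closedComplemented.isCompl_complement.sup_eq_top),
    fun h => E.ne_bot (by simpa [h] using E.closedComplemented.isCompl_complement.inf_eq_bot)⟩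
  isCompl := E.closedComplemented.isCompl_complement

namespace ComplementaryPair

variable (p q : ComplementaryPair 𝕜 X)

/-- The projection onto `E` along `F`, for `p = (E, F)`. -/
def fstProj : X →L[𝕜] p.fst.toSubmodule :=
  p.fst.toSubmodule.projectionOntoL p.snd.toSubmodule (isTopCompl p.isCompl)

/-- The projection onto `F` along `E`, for `p = (E, F)`. -/
def sndProj : X →L[𝕜] p.snd.toSubmodule :=
  p.snd.toSubmodule.projectionOntoL p.fst.toSubmodule (isTopCompl p.isCompl.symm)

@[simp] theorem fstProj_fst (e : p.fst.toSubmodule) : p.fstProj e = e :=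
  Submodule.projectionOntoL_apply_left _ e

@[simp] theorem fstProj_snd (f : p.snd.toSubmodule) : p.fstProj f = 0 :=
  Submodule.projectionOntoL_apply_right _ f

theorem fstProj_add_sndProj (x : X) : (p.fstProj x : X) + p.sndProj x = x :=
  Submodule.projectionL_add_projectionL_eq_self (isTopCompl p.isCompl) x

theorem fstProj_eq_zero_iff {x : X} : p.fstProj x = 0 ↔ x ∈ p.snd.toSubmodule :=
  Submodule.projectionOntoL_apply_eq_zero_iff _

@[simp] theorem fstProj_graphEmb (T : p.Slope) (e : p.fst.toSubmodule) :
    p.fstProj (p.graphEmb T e) = e := by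
  simp [graphEmb_apply]

theorem graphEmb_injective (T : p.Slope) : Function.Injective (p.graphEmb T) :=
  Function.LeftInverse.injective (g := p.fstProj) (p.fstProj_graphEmb T)

section Slope

variable {p} {M : Type*} [NormedAddCommGroup M] [NormedSpace 𝕜 M]

variable (p) in
/-- The slope of the range of `j`, seen as a graph for the pair `p`. It is meaningful if the
component of `j` along the first member of `p` is invertible. -/
def slope (j : M →L[𝕜] X) : p.Slope := (p.sndProj ∘L j) ∘L (p.fstProj ∘L j).inverse

theorem graphEmb_slope {j : M →L[𝕜] X} (hj : (p.fstProj ∘L j).IsInvertible) :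
    p.graphEmb (p.slope j) ∘L (p.fstProj ∘L j) = j := by
  ext m
  have hm : (p.fstProj ∘L j).inverse (p.fstProj (j m)) = m := hj.inverse_apply_self m
  simp [graphEmb_apply, slope, hm, fstProj_add_sndProj]

theorem graph_slope {j : M →L[𝕜] X} (hj : (p.fstProj ∘L j).IsInvertible) :
    p.graph (p.slope j) = LinearMap.range (j : M →ₗ[𝕜] X) := by
  conv_rhs => rw [← graphEmb_slope hj]
  exact (LinearMap.range_comp_of_range_eq_top _ (LinearMap.range_eq_top.2 hj.surjective)).symm

variable [CompleteSpace M]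

theorem isInvertible_fstProj_comp_iff {j : M →L[𝕜] X} (hj : Function.Injective j) :
    (p.fstProj ∘L j).IsInvertible ↔
      IsCompl (LinearMap.range (j : M →ₗ[𝕜] X)) p.snd.toSubmodule := by
  refine ⟨fun h => graph_slope h ▸ p.isCompl_graph _, fun h => ?_⟩
  have hinj : Function.Injective (p.fstProj ∘L j) := by
    refine (injective_iff_map_eq_zero _).2 fun m hm => hj ?_
    rw [map_zero]
    exact Submodule.disjoint_def.1 h.disjoint _ ⟨m, rfl⟩ (p.fstProj_eq_zero_iff.1 hm)
  have hsurj : Function.Surjective (p.fstProj ∘L j) := fun e => by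
    obtain ⟨_, f, ⟨m, rfl⟩, hf, he⟩ := Submodule.codisjoint_iff_exists_add_eq.1 h.codisjoint e
    refine ⟨m, ?_⟩
    simpa [p.fstProj_eq_zero_iff.2 hf] using congrArg p.fstProj he
  exact ⟨.ofBijective _ (LinearMap.ker_eq_bot.2 hinj) (LinearMap.range_eq_top.2 hsurj),
    ContinuousLinearEquiv.coe_ofBijective _ _ _⟩

theorem contDiffAt_slope {n : WithTop ℕ∞} {j : M →L[𝕜] X} (hj : (p.fstProj ∘L j).IsInvertible) :
    ContDiffAt 𝕜 n p.slope j :=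
  (contDiffAt_const.clm_comp contDiffAt_id).clm_comp
    (hj.contDiffAt_map_inverse.comp j (contDiffAt_const.clm_comp contDiffAt_id))

theorem continuousAt_slope {j : M →L[𝕜] X} (hj : (p.fstProj ∘L j).IsInvertible) :
    ContinuousAt p.slope j := (contDiffAt_slope (n := 0) hj).continuousAt

theorem isOpen_setOf_isInvertible_fstProj_comp :
    IsOpen {j : M →L[𝕜] X | (p.fstProj ∘L j).IsInvertible} :=
  ContinuousLinearEquiv.isOpen.preimage (continuous_const.clm_comp continuous_id)

end Slope

/-- The chart of the Grassmann manifold defined by `p`: the inverse of `p.graphMap`. -/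
def coord : PartialEquiv (BanachGrassmannian 𝕜 X) p.Slope :=
  (p.bijOn_graphMap.toPartialEquiv p.graphMap univ _).symm

theorem coord_mem_grassmannAtlas : ⟨p.Slope, p.coord⟩ ∈ grassmannAtlas 𝕜 X := ⟨p, rfl⟩

variable {p q}

theorem graphMap_coord {E : BanachGrassmannian 𝕜 X} (hE : E ∈ p.coord.source) :
    p.graphMap (p.coord E) = E := p.coord.left_inv hE

variable (p) in
@[simp] theorem coord_graphMap (T : p.Slope) : p.coord (p.graphMap T) = T :=
  p.coord.right_inv (mem_univ T)

variable (p) in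
@[simp] theorem graphMap_zero : p.graphMap 0 = p.fst :=
  BanachGrassmannian.ext (Submodule.ext fun x => by simp [graphMap, mem_graph])

variable (p) in
@[simp] theorem coord_fst : p.coord p.fst = 0 := by
  conv_lhs => rw [← p.graphMap_zero, coord_graphMap]

theorem coord_eq_slope {M : Type*} [NormedAddCommGroup M] [NormedSpace 𝕜 M] {j : M →L[𝕜] X}
    {E : BanachGrassmannian 𝕜 X} (hE : LinearMap.range (j : M →ₗ[𝕜] X) = E.toSubmodule)
    (hj : (p.fstProj ∘L j).IsInvertible) : p.coord E = p.slope j := by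
  rw [← p.coord_graphMap (p.slope j)]
  exact congrArg _ (BanachGrassmannian.ext (hE.symm.trans (graph_slope hj).symm))

theorem graphMap_mem_coord_source_iff {T : p.Slope} :
    p.graphMap T ∈ q.coord.source ↔ (q.fstProj ∘L p.graphEmb T).IsInvertible :=
  (isInvertible_fstProj_comp_iff (p.graphEmb_injective T)).symm

variable (p q) in
theorem isOpen_preimage_graphMap_coord_source : IsOpen (p.graphMap ⁻¹' q.coord.source) := by
  have h : p.graphMap ⁻¹' q.coord.source =
      p.graphEmb ⁻¹' {j | (q.fstProj ∘L j).IsInvertible} :=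
    Set.ext fun T => graphMap_mem_coord_source_iff
  rw [h]
  exact isOpen_setOf_isInvertible_fstProj_comp.preimage (p.contDiff_graphEmb (n := 0)).continuous

theorem contDiffAt_coord_graphMap {n : WithTop ℕ∞} {T : p.Slope}
    (hT : p.graphMap T ∈ q.coord.source) : ContDiffAt 𝕜 n (q.coord ∘ p.graphMap) T := by
  have hslope : ContDiffAt 𝕜 n (fun S => q.slope (p.graphEmb S)) T :=
    ContDiffAt.comp (g := q.slope) T (contDiffAt_slope (graphMap_mem_coord_source_iff.1 hT))
      p.contDiff_graphEmb.contDiffAt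
  refine hslope.congr_of_eventuallyEq ?_
  filter_upwards [(isOpen_preimage_graphMap_coord_source p q).mem_nhds hT] with S hS
  exact coord_eq_slope (E := p.graphMap S) (p.range_graphEmb S)
    (graphMap_mem_coord_source_iff.1 hS)

variable (p) in
theorem continuous_graphMap : Continuous p.graphMap :=
  continuous_iff_coinduced_le.2 (le_iSup
    (fun p : ComplementaryPair 𝕜 X => TopologicalSpace.coinduced p.graphMap inferInstance) p)

theorem isOpen_grassmannian_iff {s : Set (BanachGrassmannian 𝕜 X)} :
    IsOpen s ↔ ∀ p : ComplementaryPair 𝕜 X, IsOpen (p.graphMap ⁻¹' s) :=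
  isOpen_iSup_iff.trans (forall_congr' fun _ => isOpen_coinduced)

variable (p) in
theorem isOpen_coord_source : IsOpen p.coord.source :=
  isOpen_grassmannian_iff.2 fun q => isOpen_preimage_graphMap_coord_source q p

variable (p) in
theorem continuousOn_coord : ContinuousOn p.coord p.coord.source := by
  refine (continuousOn_open_iff p.isOpen_coord_source).2 fun O hO =>
    isOpen_grassmannian_iff.2 fun q => ?_
  have h : ContinuousOn (p.coord ∘ q.graphMap) (q.graphMap ⁻¹' p.coord.source) := fun T hT =>
    (contDiffAt_coord_graphMap (n := 0) hT).continuousAt.continuousWithinAt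
  exact h.isOpen_inter_preimage (isOpen_preimage_graphMap_coord_source q p) hO

theorem continuousAt_coord {E : BanachGrassmannian 𝕜 X} (hE : E ∈ p.coord.source) :
    ContinuousAt p.coord E :=
  p.continuousOn_coord.continuousAt (p.isOpen_coord_source.mem_nhds hE)

/-- The projection onto the graph of `T` along `F`, for `p = (E, F)`. -/
def graphProj (p : ComplementaryPair 𝕜 X) (T : p.Slope) : X →L[𝕜] X := p.graphEmb T ∘L p.fstProj

variable (p) in
theorem graphProj_mem (T : p.Slope) : p.graphProj T ∈ projectionsOnto (p.graph T) where
  map_mem x := ⟨p.fstProj x, rfl⟩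
  map_id := by
    rintro _ ⟨e, rfl⟩
    exact congrArg (p.graphEmb T) (p.fstProj_graphEmb T e)

theorem graphProj_coord_mem {E : BanachGrassmannian 𝕜 X} (hE : E ∈ p.coord.source) :
    p.graphProj (p.coord E) ∈ projectionsOnto E.toSubmodule := by
  have h : p.graph (p.coord E) = E.toSubmodule := congrArg (·.toSubmodule) (graphMap_coord hE)
  exact h ▸ p.graphProj_mem _

variable (p) in
theorem graphProj_mul_graphProj (S T : p.Slope) : p.graphProj S * p.graphProj T = p.graphProj S :=
  ContinuousLinearMap.ext fun x => congrArg (p.graphEmb S) (p.fstProj_graphEmb T (p.fstProj x))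

variable (p) in
theorem contDiff_graphProj {n : WithTop ℕ∞} : ContDiff 𝕜 n p.graphProj :=
  p.contDiff_graphEmb.clm_comp contDiff_const

theorem continuousAt_graphProj_coord {E : BanachGrassmannian 𝕜 X} (hE : E ∈ p.coord.source) :
    ContinuousAt (fun E => p.graphProj (p.coord E)) E :=
  (p.contDiff_graphProj (n := 0)).continuous.continuousAt.comp (continuousAt_coord hE)

end ComplementaryPair

open ComplementaryPair

theorem BanachGrassmannian.mem_coord_source (E : BanachGrassmannian 𝕜 X) :
    E ∈ E.pair.coord.source := E.pair.isCompl

theorem isClosed_setOf_toSubmodule_le : IsClosed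
    {E : BanachGrassmannian 𝕜 X × BanachGrassmannian 𝕜 X | E.1.toSubmodule ≤ E.2.toSubmodule} := by
  refine isOpen_compl_iff.1 (isOpen_iff_eventually.2 fun ⟨E, E'⟩ hE => ?_)
  let p := E.pair
  let q := E'.pair
  have hP : ContinuousAt (fun D : BanachGrassmannian 𝕜 X × BanachGrassmannian 𝕜 X =>
      p.graphProj (p.coord D.1)) (E, E') :=
    ContinuousAt.comp (g := fun E => p.graphProj (p.coord E)) (f := Prod.fst)
      (continuousAt_graphProj_coord E.mem_coord_source) continuousAt_fst
  have hQ : ContinuousAt (fun D : BanachGrassmannian 𝕜 X × BanachGrassmannian 𝕜 X =>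
      q.graphProj (q.coord D.2)) (E, E') :=
    ContinuousAt.comp (g := fun E => q.graphProj (q.coord E)) (f := Prod.snd)
      (continuousAt_graphProj_coord E'.mem_coord_source) continuousAt_snd
  have hne : q.graphProj (q.coord E') * p.graphProj (p.coord E) ≠ p.graphProj (p.coord E) :=
    fun h => hE ((projectionsOnto.mul_eq_right_iff (graphProj_coord_mem E.mem_coord_source)
      (graphProj_coord_mem E'.mem_coord_source)).1 h)
  filter_upwards [(ContinuousAt.ne_iff_eventually_ne (hQ.mul hP) hP).1 hne,
    continuousAt_fst (p.isOpen_coord_source.mem_nhds E.mem_coord_source),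
    continuousAt_snd (q.isOpen_coord_source.mem_nhds E'.mem_coord_source)] with D hD hD₁ hD₂ hle
  exact hD ((projectionsOnto.mul_eq_right_iff (graphProj_coord_mem hD₁)
    (graphProj_coord_mem hD₂)).2 hle)

instance : T2Space (BanachGrassmannian 𝕜 X) := by
  refine t2_iff_isClosed_diagonal.2 ?_
  have hdiag : diagonal (BanachGrassmannian 𝕜 X) =
      {E | E.1.toSubmodule ≤ E.2.toSubmodule} ∩ {E | E.2.toSubmodule ≤ E.1.toSubmodule} :=
    Set.ext fun E => BanachGrassmannian.ext_iff.trans le_antisymm_iff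
  rw [hdiag]
  exact isClosed_setOf_toSubmodule_le.inter
    (isClosed_setOf_toSubmodule_le.preimage continuous_swap)

theorem isBanachManifold_grassmannAtlas : IsBanachManifold (grassmannAtlas 𝕜 X) where
  t2 := inferInstance
  complete := by rintro _ ⟨p, rfl⟩; exact (inferInstance : CompleteSpace p.Slope)
  cover E := ⟨_, E.pair.coord_mem_grassmannAtlas, E.mem_coord_source⟩
  isOpen_source := by rintro _ ⟨p, rfl⟩; exact p.isOpen_coord_source
  isOpen_target := by rintro _ ⟨p, rfl⟩; exact isOpen_univ
  continuousOn := by rintro _ ⟨p, rfl⟩; exact p.continuousOn_coord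
  continuousOn_symm := by rintro _ ⟨p, rfl⟩; exact p.continuous_graphMap.continuousOn
  analytic := by
    rintro _ ⟨p, rfl⟩ _ ⟨q, rfl⟩ T hT
    exact (contDiffAt_coord_graphMap (n := ⊤) hT.2).analyticAt

end Grassmannian

section Idempotents

variable {𝕜 : Type*} [RCLike 𝕜] {X : Type*} [NormedAddCommGroup X] [NormedSpace 𝕜 X]

namespace Idempotents

theorem isTopCompl_range_ker (Q : Idempotents 𝕜 X) :
    Submodule.IsTopCompl (LinearMap.range (Q.1 : X →ₗ[𝕜] X)) (LinearMap.ker (Q.1 : X →ₗ[𝕜] X)) :=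
  ContinuousLinearMap.IsIdempotentElem.isTopCompl Q.2.1

theorem mem_projectionsOnto (Q : Idempotents 𝕜 X) :
    Q.1 ∈ projectionsOnto (LinearMap.range (Q.1 : X →ₗ[𝕜] X)) where
  map_mem x := ⟨x, rfl⟩
  map_id := by rintro _ ⟨x, rfl⟩; exact DFunLike.congr_fun Q.2.1 x

/-- The pair formed by the range and the kernel of an idempotent. -/
def toPair (Q : Idempotents 𝕜 X) : ComplementaryPair 𝕜 X where
  fst := ⟨LinearMap.range (Q.1 : X →ₗ[𝕜] X), Q.isTopCompl_range_ker.closedComplemented,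
    fun h => Q.2.2.1 (ContinuousLinearMap.coe_inj.1 (LinearMap.range_eq_bot.1 h)),
    fun h => Q.2.2.2 (ContinuousLinearMap.ext fun x =>
      Q.mem_projectionsOnto.map_id x (h ▸ Submodule.mem_top))⟩
  snd := ⟨LinearMap.ker (Q.1 : X →ₗ[𝕜] X), Q.isTopCompl_range_ker.symm.closedComplemented,
    fun h => Q.2.2.2 (ContinuousLinearMap.ext fun x =>
      LinearMap.ker_eq_bot.1 h (DFunLike.congr_fun Q.2.1 x)),
    fun h => Q.2.2.1 (ContinuousLinearMap.coe_inj.1 (LinearMap.ker_eq_top.1 h))⟩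
  isCompl := Q.isTopCompl_range_ker.isCompl

/-- The idempotent `1 - Q`, which exchanges the range and the kernel of `Q`. -/
def compl (Q : Idempotents 𝕜 X) : Idempotents 𝕜 X :=
  ⟨1 - Q.1, Q.2.1.one_sub, sub_ne_zero.2 Q.2.2.2.symm, fun h => Q.2.2.1 (sub_eq_self.1 h)⟩

theorem toPair_compl_fst (Q : Idempotents 𝕜 X) : Q.compl.toPair.fst = Q.toPair.snd :=
  BanachGrassmannian.ext (LinearMap.IsIdempotentElem.ker_eq_range_one_sub
    (ContinuousLinearMap.IsIdempotentElem.toLinearMap Q.2.1)).symm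

theorem continuous_compl : Continuous (compl : Idempotents 𝕜 X → Idempotents 𝕜 X) :=
  (continuous_const.sub continuous_subtype_val).subtype_mk _

variable [CompleteSpace X]

theorem toPair_idempotent (p : ComplementaryPair 𝕜 X) : p.idempotent.toPair = p :=
  ComplementaryPair.ext (BanachGrassmannian.ext p.range_ker_idempotent.1)
    (BanachGrassmannian.ext p.range_ker_idempotent.2)

theorem idempotent_toPair (Q : Idempotents 𝕜 X) : Q.toPair.idempotent = Q :=
  Subtype.ext (ContinuousLinearMap.IsIdempotentElem.ext Q.toPair.idempotent.2.1 Q.2.1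
    Q.toPair.range_ker_idempotent)

end Idempotents

theorem range_comp_subtypeL_of_isUnit {E : Submodule 𝕜 X} {A Q : X →L[𝕜] X}
    (hA : IsIdempotentElem A) (hQ : Q ∈ projectionsOnto E) (hu : IsUnit (1 - A + Q)) :
    LinearMap.range (A ∘L E.subtypeL : E →ₗ[𝕜] X) = LinearMap.range (A : X →ₗ[𝕜] X) := by
  refine le_antisymm (LinearMap.range_comp_le_range _ _) ?_
  rintro _ ⟨x, rfl⟩
  obtain ⟨u, hu⟩ := hu
  have hAu : A * u = A * Q := by rw [hu, mul_add, mul_one_sub, hA.eq, sub_self, zero_add]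
  have hAQ : A = A * Q * ↑u⁻¹ := by rw [← hAu, mul_assoc, u.mul_inv, mul_one]
  exact ⟨⟨Q ((↑u⁻¹ : X →L[𝕜] X) x), hQ.map_mem _⟩, (DFunLike.congr_fun hAQ x).symm⟩

variable [CompleteSpace X]

namespace Idempotents

variable {p : ComplementaryPair 𝕜 X} {Q : Idempotents 𝕜 X}

theorem isInvertible_fstProj_comp_subtypeL (hQ : Q.toPair.fst ∈ p.coord.source) :
    (p.fstProj ∘L (Q.1 ∘L Q.toPair.fst.toSubmodule.subtypeL)).IsInvertible := by
  have hid : Q.1 ∘L Q.toPair.fst.toSubmodule.subtypeL = Q.toPair.fst.toSubmodule.subtypeL :=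
    ContinuousLinearMap.ext fun e => Q.mem_projectionsOnto.map_id e e.2
  rw [hid]
  refine (ComplementaryPair.isInvertible_fstProj_comp_iff Subtype.val_injective).2 ?_
  rwa [Submodule.toLinearMap_subtypeL, Submodule.range_subtype]

theorem eventually_coord_toPair_fst_eq (hQ : Q.toPair.fst ∈ p.coord.source) :
    ∀ᶠ A : Idempotents 𝕜 X in 𝓝 Q, A.toPair.fst ∈ p.coord.source ∧
      p.coord A.toPair.fst = p.slope (A.1 ∘L Q.toPair.fst.toSubmodule.subtypeL) := by
  have hunit : ∀ᶠ A : Idempotents 𝕜 X in 𝓝 Q, IsUnit (1 - A.1 + Q.1) := by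
    have hcont : Continuous fun A : Idempotents 𝕜 X => 1 - A.1 + Q.1 :=
      (continuous_const.sub continuous_subtype_val).add continuous_const
    exact hcont.continuousAt.eventually_mem (Units.isOpen.mem_nhds (by simp))
  have hinv : ∀ᶠ A : Idempotents 𝕜 X in 𝓝 Q,
      (p.fstProj ∘L (A.1 ∘L Q.toPair.fst.toSubmodule.subtypeL)).IsInvertible := by
    have hcont : Continuous fun A : Idempotents 𝕜 X =>
        A.1 ∘L Q.toPair.fst.toSubmodule.subtypeL :=
      continuous_subtype_val.clm_comp continuous_const
    exact hcont.continuousAt.eventually_mem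
      (ComplementaryPair.isOpen_setOf_isInvertible_fstProj_comp.mem_nhds
        (isInvertible_fstProj_comp_subtypeL hQ))
  filter_upwards [hunit, hinv] with A hu hA
  have hrange := range_comp_subtypeL_of_isUnit A.2.1 Q.mem_projectionsOnto hu
  have hgraph : p.graphMap (p.slope (A.1 ∘L Q.toPair.fst.toSubmodule.subtypeL)) = A.toPair.fst :=
    BanachGrassmannian.ext ((ComplementaryPair.graph_slope hA).trans hrange)
  exact ⟨hgraph ▸ p.isCompl_graph _, ComplementaryPair.coord_eq_slope hrange hA⟩

theorem continuous_toPair_fst : Continuous fun Q : Idempotents 𝕜 X => Q.toPair.fst := by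
  refine continuous_iff_continuousAt.2 fun Q => ?_
  have hQ : Q.toPair.fst ∈ Q.toPair.coord.source := Q.toPair.isCompl
  have hcomp : ContinuousAt (fun A : Idempotents 𝕜 X =>
      A.1 ∘L Q.toPair.fst.toSubmodule.subtypeL) Q :=
    (continuous_subtype_val.clm_comp continuous_const).continuousAt
  have hslope : ContinuousAt (fun A : Idempotents 𝕜 X =>
      Q.toPair.slope (A.1 ∘L Q.toPair.fst.toSubmodule.subtypeL)) Q :=
    ContinuousAt.comp (g := Q.toPair.slope) (ComplementaryPair.continuousAt_slope
      (isInvertible_fstProj_comp_subtypeL hQ)) hcomp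
  refine (Q.toPair.continuous_graphMap.continuousAt.comp hslope).congr ?_
  filter_upwards [eventually_coord_toPair_fst_eq hQ] with A hA
  rw [Function.comp_apply, ← hA.2, ComplementaryPair.graphMap_coord hA.1]

theorem continuous_toPair :
    Continuous (toPair : Idempotents 𝕜 X → ComplementaryPair 𝕜 X) := by
  refine continuous_induced_rng.2 (continuous_toPair_fst.prodMk ?_)
  exact (continuous_toPair_fst.comp continuous_compl).congr toPair_compl_fst

end Idempotents

namespace ComplementaryPair

theorem continuous_fst : Continuous (fst : ComplementaryPair 𝕜 X → BanachGrassmannian 𝕜 X) :=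
  Continuous.fst (f := fun p : ComplementaryPair 𝕜 X => (p.fst, p.snd)) continuous_induced_dom

theorem continuous_snd : Continuous (snd : ComplementaryPair 𝕜 X → BanachGrassmannian 𝕜 X) :=
  Continuous.snd (f := fun p : ComplementaryPair 𝕜 X => (p.fst, p.snd)) continuous_induced_dom

variable (p : ComplementaryPair 𝕜 X)

/-- The pair `(F, E)`, for `p = (E, F)`. -/
def swap : ComplementaryPair 𝕜 X := ⟨p.snd, p.fst, p.isCompl.symm⟩

/-- The projection `Q_E^F`, for `p = (E, F)`, as a point of the space of projections onto `E`. -/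
def proj : projectionsOnto p.fst.toSubmodule :=
  ⟨p.idempotent.1, p.range_ker_idempotent.1 ▸ p.idempotent.mem_projectionsOnto⟩

theorem coe_proj : (p.proj : X →L[𝕜] X) = p.idempotent := rfl

theorem graphProj_zero : p.graphProj 0 = p.proj :=
  ContinuousLinearMap.ext fun x => add_zero (p.fstProj x : X)

theorem idempotent_apply_snd {x : X} (hx : x ∈ p.snd.toSubmodule) : p.idempotent.1 x = 0 := by
  rwa [← p.range_ker_idempotent.2] at hx

theorem graphProj_zero_add_swap_graphProj_zero : p.graphProj 0 + p.swap.graphProj 0 = 1 := by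
  ext x
  simpa [graphProj, graphEmb_apply] using! p.fstProj_add_sndProj x

variable {p} in
theorem idempotent_mul_graphProj_add_graphProj {r : ComplementaryPair 𝕜 X}
    (hfst : r.fst ∈ p.coord.source) (hsnd : r.snd ∈ p.swap.coord.source) :
    r.idempotent.1 * (p.graphProj (p.coord r.fst) + p.swap.graphProj (p.swap.coord r.snd)) =
      p.graphProj (p.coord r.fst) := by
  ext x
  have hE := r.proj.2.map_id _ ((graphProj_coord_mem hfst).map_mem x)
  have hF := r.idempotent_apply_snd ((graphProj_coord_mem hsnd).map_mem x)
  simpa [hF, coe_proj] using hE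

theorem continuous_idempotent :
    Continuous (idempotent : ComplementaryPair 𝕜 X → Idempotents 𝕜 X) := by
  refine Continuous.subtype_mk (continuous_iff_continuousAt.2 fun p => ?_) _
  have hP : ContinuousAt (fun r : ComplementaryPair 𝕜 X => p.graphProj (p.coord r.fst)) p :=
    ContinuousAt.comp (g := fun E => p.graphProj (p.coord E))
      (continuousAt_graphProj_coord p.isCompl) continuous_fst.continuousAt
  have hP' : ContinuousAt
      (fun r : ComplementaryPair 𝕜 X => p.swap.graphProj (p.swap.coord r.snd)) p :=
    ContinuousAt.comp (g := fun E => p.swap.graphProj (p.swap.coord E))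
      (continuousAt_graphProj_coord p.swap.isCompl) continuous_snd.continuousAt
  have hone : p.graphProj (p.coord p.fst) + p.swap.graphProj (p.swap.coord p.snd) =
      (1 : (X →L[𝕜] X)ˣ) := by
    rw [p.coord_fst, show p.swap.coord p.snd = 0 from p.swap.coord_fst]
    exact p.graphProj_zero_add_swap_graphProj_zero
  have hunit : ∀ᶠ r : ComplementaryPair 𝕜 X in 𝓝 p,
      IsUnit (p.graphProj (p.coord r.fst) + p.swap.graphProj (p.swap.coord r.snd)) :=
    (hP.add hP').eventually_mem (Units.isOpen.mem_nhds ⟨1, hone.symm⟩)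
  have hinv : ContinuousAt (fun r : ComplementaryPair 𝕜 X => p.graphProj (p.coord r.fst) *
      Ring.inverse (p.graphProj (p.coord r.fst) + p.swap.graphProj (p.swap.coord r.snd))) p := by
    refine hP.mul (ContinuousAt.comp (g := Ring.inverse) ?_ (hP.add hP'))
    exact hone ▸ NormedRing.inverse_continuousAt 1
  refine hinv.congr ?_
  filter_upwards [hunit, continuous_fst.continuousAt (p.isOpen_coord_source.mem_nhds p.isCompl),
    continuous_snd.continuousAt (p.swap.isOpen_coord_source.mem_nhds p.swap.isCompl)]
    with r hu hfst hsnd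
  calc _ = r.idempotent.1 * (p.graphProj (p.coord r.fst) + p.swap.graphProj (p.swap.coord r.snd)) *
        Ring.inverse (p.graphProj (p.coord r.fst) + p.swap.graphProj (p.swap.coord r.snd)) := by
        rw [idempotent_mul_graphProj_add_graphProj hfst hsnd]
    _ = r.idempotent.1 := Ring.mul_inverse_cancel_right _ _ hu

variable (𝕜 X) in
/-- The correspondence `(E, F) ↦ Q_E^F` between pairs of complementary subspaces and idempotents. -/
def idempotentHomeomorph : ComplementaryPair 𝕜 X ≃ₜ Idempotents 𝕜 X where
  toFun := idempotent
  invFun := Idempotents.toPair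
  left_inv := Idempotents.toPair_idempotent
  right_inv := Idempotents.idempotent_toPair
  continuous_toFun := continuous_idempotent
  continuous_invFun := Idempotents.continuous_toPair

instance : T2Space (ComplementaryPair 𝕜 X) := (idempotentHomeomorph 𝕜 X).isEmbedding.t2Space

end ComplementaryPair

instance (E : BanachGrassmannian 𝕜 X) : Nonempty (projectionsOnto E.toSubmodule) := ⟨E.pair.proj⟩

end Idempotents

section PairManifold

variable {𝕜 : Type*} [RCLike 𝕜] {X : Type*} [NormedAddCommGroup X] [NormedSpace 𝕜 X]

namespace BanachGrassmannian

variable {E : BanachGrassmannian 𝕜 X}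

theorem isIdempotentElem_and_ne (A : projectionsOnto E.toSubmodule) :
    IsIdempotentElem A.1 ∧ A.1 ≠ 0 ∧ A.1 ≠ 1 := by
  refine ⟨projectionsOnto.mul_eq_right A.2 A.2, fun h => E.ne_bot ?_, fun h => E.ne_top ?_⟩
  · simp [← projectionsOnto.range_eq A.2, h]
  · rw [← projectionsOnto.range_eq A.2, h]
    exact LinearMap.range_id

/-- The pair `(E, ker A)` for a projection `A` onto `E`. -/
def pairOfProjection (A : projectionsOnto E.toSubmodule) : ComplementaryPair 𝕜 X :=
  Idempotents.toPair ⟨A, isIdempotentElem_and_ne A⟩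

theorem pairOfProjection_fst (A : projectionsOnto E.toSubmodule) : (pairOfProjection A).fst = E :=
  BanachGrassmannian.ext (projectionsOnto.range_eq A.2)

variable [CompleteSpace X]

theorem idempotent_pairOfProjection (A : projectionsOnto E.toSubmodule) :
    (pairOfProjection A).idempotent.1 = A :=
  congrArg Subtype.val (Idempotents.idempotent_toPair _)

theorem pairOfProjection_eq {A : projectionsOnto E.toSubmodule} {p : ComplementaryPair 𝕜 X}
    (h : A.1 = p.idempotent) : pairOfProjection A = p := by
  rw [← Idempotents.toPair_idempotent p]
  exact congrArg Idempotents.toPair (Subtype.ext h)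

end BanachGrassmannian

open BanachGrassmannian

variable [CompleteSpace X]

namespace ComplementaryPair

variable {M : Type*} [TopologicalSpace M] {f : M → ComplementaryPair 𝕜 X}

theorem continuous_iff_continuous_idempotent :
    Continuous f ↔ Continuous fun x => ((f x).idempotent : X →L[𝕜] X) :=
  (idempotentHomeomorph 𝕜 X).isInducing.continuous_iff.trans continuous_induced_rng

variable (p : ComplementaryPair 𝕜 X)

/-- The model space of the chart of the manifold of complementary pairs defined by `p`. -/
abbrev PairModel : Type _ := p.Slope × (projectionsOnto p.fst.toSubmodule).direction

/-- The projection onto the graph of the slope `z.1` whose coordinate along the space of these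
projections is `z.2`. -/
def paramProj (z : p.PairModel) : projectionsOnto (p.graphMap z.1).toSubmodule :=
  ⟨projectionRetraction (p.graphProj z.1) (z.2 + p.proj),
    projectionRetraction_mem (p.graphProj_mem z.1) _⟩

theorem coe_paramProj (z : p.PairModel) :
    (p.paramProj z : X →L[𝕜] X) = projectionRetraction (p.graphProj z.1) (z.2 + p.proj) := rfl

theorem compress_paramProj (z : p.PairModel) :
    projectionsOnto.compress p.proj (p.paramProj z) = z.2 := by
  rw [coe_paramProj, projectionsOnto.compress_projectionRetraction _
    (p.graphProj_zero ▸ p.graphProj_mul_graphProj _ _)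
    (p.graphProj_zero ▸ p.graphProj_mul_graphProj _ _)]
  exact projectionsOnto.compress_coe_add _ _

theorem projectionRetraction_compress_add {r : ComplementaryPair 𝕜 X}
    (hr : r.fst ∈ p.coord.source) :
    projectionRetraction (p.graphProj (p.coord r.fst))
      (projectionsOnto.compress p.proj r.idempotent.1 + p.proj) = r.idempotent := by
  rw [projectionsOnto.coe_compress_add, projectionRetraction_projectionRetraction
    (p.graphProj_zero ▸ p.graphProj_mul_graphProj _ _)
    (p.graphProj_zero ▸ p.graphProj_mul_graphProj _ _)]
  exact projectionRetraction_of_mem (graphProj_coord_mem hr) r.proj.2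

/-- The chart `r = (E', F') ↦ (T, D)` of the manifold of complementary pairs defined by
`p = (E, F)`: here `E'` is the graph of `T : E → F`, and `D` is the difference between the image
of `Q_{E'}^{F'}` in the space of projections onto `E` and `Q_E^F`. -/
def pairChart : PartialEquiv (ComplementaryPair 𝕜 X) p.PairModel where
  toFun r := (p.coord r.fst, projectionsOnto.compress p.proj r.idempotent.1)
  invFun z := pairOfProjection (p.paramProj z)
  source := {r | r.fst ∈ p.coord.source}
  target := univ
  map_source' _ _ := mem_univ _
  map_target' z _ := by
    rw [mem_ofPred_eq, pairOfProjection_fst]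
    exact p.isCompl_graph z.1
  left_inv' r hr := pairOfProjection_eq (p.projectionRetraction_compress_add hr)
  right_inv' z _ := Prod.ext (by rw [pairOfProjection_fst, coord_graphMap])
    (by rw [idempotent_pairOfProjection, compress_paramProj])

theorem pairChart_apply (r : ComplementaryPair 𝕜 X) :
    p.pairChart r = (p.coord r.fst, projectionsOnto.compress p.proj r.idempotent.1) := rfl

theorem pairChart_symm_fst (z : p.PairModel) : (p.pairChart.symm z).fst = p.graphMap z.1 :=
  pairOfProjection_fst _

theorem idempotent_pairChart_symm (z : p.PairModel) :
    ((p.pairChart.symm z).idempotent : X →L[𝕜] X) =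
      projectionRetraction (p.graphProj z.1) (z.2 + p.proj) :=
  idempotent_pairOfProjection _

theorem contDiff_idempotent_pairChart_symm {n : WithTop ℕ∞} :
    ContDiff 𝕜 n fun z => ((p.pairChart.symm z).idempotent : X →L[𝕜] X) := by
  simp only [idempotent_pairChart_symm, projectionRetraction_apply]
  have hG : ContDiff 𝕜 n fun z : p.PairModel => p.graphProj z.1 :=
    p.contDiff_graphProj.comp contDiff_fst
  have hD : ContDiff 𝕜 n fun z : p.PairModel => (z.2 + p.proj : X →L[𝕜] X) :=
    ((projectionsOnto p.fst.toSubmodule).direction.subtypeL.contDiff.comp contDiff_snd).add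
      contDiff_const
  exact ((hG.mul hD).mul (contDiff_const.sub hG)).add hG

theorem isOpen_pairChart_source : IsOpen p.pairChart.source :=
  p.isOpen_coord_source.preimage continuous_fst

theorem continuousOn_pairChart : ContinuousOn p.pairChart p.pairChart.source :=
  (p.continuousOn_coord.comp continuous_fst.continuousOn fun _ hr => hr).prodMk
    ((projectionsOnto.compress p.proj).continuous.comp
      (continuous_subtype_val.comp continuous_idempotent)).continuousOn

theorem continuous_pairChart_symm : Continuous p.pairChart.symm :=
  continuous_iff_continuous_idempotent.2 (p.contDiff_idempotent_pairChart_symm (n := 0)).continuous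

variable {p} in
theorem contDiffAt_pairChart_pairChart_symm {q : ComplementaryPair 𝕜 X} {n : WithTop ℕ∞}
    {z : p.PairModel} (hz : p.pairChart.symm z ∈ q.pairChart.source) :
    ContDiffAt 𝕜 n (fun w => q.pairChart (p.pairChart.symm w)) z := by
  simp only [pairChart_apply, pairChart_symm_fst]
  refine ContDiffAt.prodMk ?_ ((projectionsOnto.compress q.proj).contDiff.comp
    p.contDiff_idempotent_pairChart_symm).contDiffAt
  have hz' : p.graphMap z.1 ∈ q.coord.source := p.pairChart_symm_fst z ▸ hz
  exact ContDiffAt.comp (g := q.coord ∘ p.graphMap) z (contDiffAt_coord_graphMap hz') contDiffAt_fst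

end ComplementaryPair

variable (𝕜 X) in
/-- The atlas of the manifold of pairs of complementary subspaces. -/
def pairAtlas : Set (BanachChart 𝕜 (ComplementaryPair 𝕜 X)) :=
  Set.range fun p : ComplementaryPair 𝕜 X => ⟨p.PairModel, p.pairChart⟩

theorem ComplementaryPair.pairChart_mem_pairAtlas (p : ComplementaryPair 𝕜 X) :
    ⟨p.PairModel, p.pairChart⟩ ∈ pairAtlas 𝕜 X := ⟨p, rfl⟩

instance (E : BanachGrassmannian 𝕜 X) :
    CompleteSpace (projectionsOnto E.toSubmodule).direction :=
  ((AffineSubspace.isClosed_direction_iff _).2 projectionsOnto.isClosed).completeSpace_coe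

theorem isBanachManifold_pairAtlas : IsBanachManifold (pairAtlas 𝕜 X) where
  t2 := inferInstance
  complete := by rintro _ ⟨p, rfl⟩; exact (inferInstance : CompleteSpace p.PairModel)
  cover p := ⟨_, p.pairChart_mem_pairAtlas, p.isCompl⟩
  isOpen_source := by rintro _ ⟨p, rfl⟩; exact p.isOpen_pairChart_source
  isOpen_target := by rintro _ ⟨p, rfl⟩; exact isOpen_univ
  continuousOn := by rintro _ ⟨p, rfl⟩; exact p.continuousOn_pairChart
  continuousOn_symm := by rintro _ ⟨p, rfl⟩; exact p.continuous_pairChart_symm.continuousOn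
  analytic := by
    rintro _ ⟨p, rfl⟩ _ ⟨q, rfl⟩ z hz
    exact (ComplementaryPair.contDiffAt_pairChart_pairChart_symm (n := ⊤) hz.2).analyticAt

theorem isAnalyticOn_idempotent : IsAnalyticOn (pairAtlas 𝕜 X) (vectorAtlas 𝕜 (X →L[𝕜] X))
    (fun p : ComplementaryPair 𝕜 X => (p.idempotent : X →L[𝕜] X)) univ :=
  .of_exists_charts isBanachManifold_pairAtlas (isBanachManifold_vectorAtlas _)
    (fun _ _ => (continuous_subtype_val.comp ComplementaryPair.continuous_idempotent).continuousAt)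
    fun p _ => ⟨_, p.pairChart_mem_pairAtlas, _, rfl, p.isCompl, mem_univ _,
      (p.contDiff_idempotent_pairChart_symm (n := ⊤)).contDiffAt.analyticAt⟩

theorem isAnalyticOn_fst :
    IsAnalyticOn (pairAtlas 𝕜 X) (grassmannAtlas 𝕜 X) ComplementaryPair.fst univ := by
  refine .of_exists_charts isBanachManifold_pairAtlas isBanachManifold_grassmannAtlas
    (fun _ _ => ComplementaryPair.continuous_fst.continuousAt)
    fun p _ => ⟨_, p.pairChart_mem_pairAtlas, _, p.coord_mem_grassmannAtlas, p.isCompl,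
      p.isCompl, ?_⟩
  simp only [ComplementaryPair.pairChart_symm_fst, ComplementaryPair.coord_graphMap]
  exact analyticAt_fst

/-- A local left inverse of the inclusion of the idempotents, in the chart defined by `p`, which is
defined and analytic in an open set of operators. -/
def ComplementaryPair.operatorChart (p : ComplementaryPair 𝕜 X) (A : X →L[𝕜] X) : p.PairModel :=
  (p.slope (A ∘L p.idempotent.toPair.fst.toSubmodule.subtypeL), projectionsOnto.compress p.proj A)

namespace ComplementaryPair

variable (p : ComplementaryPair 𝕜 X)

theorem toPair_idempotent_fst_mem_coord_source : p.idempotent.toPair.fst ∈ p.coord.source :=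
  (Idempotents.toPair_idempotent p).symm ▸ p.isCompl

theorem differentiableAt_operatorChart : DifferentiableAt 𝕜 p.operatorChart p.idempotent.1 := by
  have hinv := Idempotents.isInvertible_fstProj_comp_subtypeL
    p.toPair_idempotent_fst_mem_coord_source
  have hslope : DifferentiableAt 𝕜 p.slope
      (p.idempotent.1 ∘L p.idempotent.toPair.fst.toSubmodule.subtypeL) :=
    (contDiffAt_slope (n := 1) hinv).differentiableAt one_ne_zero
  have hcomp : DifferentiableAt 𝕜
      (fun A : X →L[𝕜] X => A ∘L p.idempotent.toPair.fst.toSubmodule.subtypeL) p.idempotent.1 :=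
    differentiableAt_id.clm_comp (differentiableAt_const _)
  exact (DifferentiableAt.comp (g := p.slope) p.idempotent.1 hslope hcomp).prodMk
    (projectionsOnto.compress p.proj).differentiableAt

theorem operatorChart_idempotent_pairChart_symm_eventuallyEq :
    p.operatorChart ∘ (fun z => (p.pairChart.symm z).idempotent.1) =ᶠ[𝓝 (p.pairChart p)] id := by
  have hcont : Filter.Tendsto (fun z => (p.pairChart.symm z).idempotent) (𝓝 (p.pairChart p))
      (𝓝 p.idempotent) := by
    have h := (continuous_idempotent.comp p.continuous_pairChart_symm).tendsto (p.pairChart p)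
    rwa [Function.comp_apply, p.pairChart.left_inv p.isCompl] at h
  filter_upwards [hcont.eventually (Idempotents.eventually_coord_toPair_fst_eq
    p.toPair_idempotent_fst_mem_coord_source)] with z hz
  rw [Idempotents.toPair_idempotent] at hz
  calc p.operatorChart (p.pairChart.symm z).idempotent.1 = p.pairChart (p.pairChart.symm z) :=
        Prod.ext hz.2.symm rfl
    _ = z := p.pairChart.right_inv (mem_univ z)

end ComplementaryPair

theorem isAnalyticImmersion_idempotent : IsAnalyticImmersion (pairAtlas 𝕜 X)
    (fun p : ComplementaryPair 𝕜 X => (p.idempotent : X →L[𝕜] X)) := by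
  refine ⟨isAnalyticOn_idempotent, fun p => ⟨_, p.pairChart_mem_pairAtlas, p.isCompl, ?_⟩⟩
  have hp : (p.pairChart.symm (p.pairChart p)).idempotent = p.idempotent := by
    rw [p.pairChart.left_inv p.isCompl]
  have hinv := leftInverse_fderiv
    ((p.contDiff_idempotent_pairChart_symm (n := 1)).differentiable one_ne_zero (p.pairChart p))
    (by simpa only [hp] using p.differentiableAt_operatorChart)
    p.operatorChart_idempotent_pairChart_symm_eventuallyEq
  exact ⟨hinv.injective, ContinuousLinearMap.closedComplemented_range_of_leftInverse _ _ hinv⟩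

end PairManifold

section Bundle

variable {𝕜 : Type*} [RCLike 𝕜] {X : Type*} [NormedAddCommGroup X] [NormedSpace 𝕜 X]
  [CompleteSpace X]

namespace BanachGrassmannian

variable (E : BanachGrassmannian 𝕜 X)

/-- The affine-Banach subspace of `𝓛(X)` consisting of the projections onto `E`. -/
abbrev fiber : AffineBanachSubspace 𝕜 (X →L[𝕜] X) :=
  ⟨projectionsOnto E.toSubmodule, inferInstance, projectionsOnto.isClosed⟩

variable {E} in
theorem idempotent_mem_projectionsOnto {r : ComplementaryPair 𝕜 X} (hr : r.fst = E) :
    r.idempotent.1 ∈ projectionsOnto E.toSubmodule := by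
  subst hr
  exact r.proj.2

/-- The identification `(E, F) ↦ Q_E^F` of the set of pairs with first member `E` with the space of
projections onto `E`. -/
def fiberHomeomorph :
    (ComplementaryPair.fst ⁻¹' {E} : Set (ComplementaryPair 𝕜 X)) ≃ₜ E.fiber.space where
  toFun r := ⟨r.1.idempotent, idempotent_mem_projectionsOnto r.2⟩
  invFun A := ⟨pairOfProjection A, pairOfProjection_fst A⟩
  left_inv _ := Subtype.ext (pairOfProjection_eq rfl)
  right_inv A := Subtype.ext (idempotent_pairOfProjection A)
  continuous_toFun := (continuous_subtype_val.comp
    (ComplementaryPair.continuous_idempotent.comp continuous_subtype_val)).subtype_mk _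
  continuous_invFun := Continuous.subtype_mk
    (ComplementaryPair.continuous_iff_continuous_idempotent.2
      (by simpa only [idempotent_pairOfProjection] using continuous_subtype_val)) _

end BanachGrassmannian

variable (𝕜 X) in
/-- The affine-Banach space structures on the fibers of `(E, F) ↦ E` that are given by the
identification of `(E, F)` with `Q_E^F`. -/
def pairFibers : AffineBanachFibers 𝕜 (fun _ : BanachGrassmannian 𝕜 X => X →L[𝕜] X)
    (ComplementaryPair.fst : ComplementaryPair 𝕜 X → BanachGrassmannian 𝕜 X) where
  fiber := BanachGrassmannian.fiber
  homeo := BanachGrassmannian.fiberHomeomorph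

namespace ComplementaryPair

open BanachGrassmannian

variable {p q : ComplementaryPair 𝕜 X} {E : BanachGrassmannian 𝕜 X}

variable (p) in
/-- The chart of `𝒢(X) × κ₁⁻¹(E)` defined by `p = (E, F)`. Its model is that of the chart
`p.pairChart`. -/
def prodChart : PartialEquiv (BanachGrassmannian 𝕜 X × p.fst.fiber.space) p.PairModel :=
  p.coord.prod (Equiv.vaddConst p.proj).symm.toPartialEquiv

variable (p) in
theorem prodChart_mem_prodAtlas :
    ⟨p.PairModel, p.prodChart⟩ ∈ prodAtlas (grassmannAtlas 𝕜 X) (affineAtlas p.fst.fiber) :=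
  ⟨_, p.coord_mem_grassmannAtlas, _, ⟨p.proj, rfl⟩, rfl⟩

theorem isBanachManifold_prodAtlas_fiber (E : BanachGrassmannian 𝕜 X) :
    IsBanachManifold (prodAtlas (grassmannAtlas 𝕜 X) (affineAtlas E.fiber)) :=
  isBanachManifold_grassmannAtlas.prod (isBanachManifold_affineAtlas E.fiber)

variable (p) in
/-- The local trivialization of `(E, F) ↦ E` around the first member of `p`: the map which is the
identity in the charts of the product and of the manifold of pairs defined by `p`. -/
def trivialization :
    OpenPartialHomeomorph (BanachGrassmannian 𝕜 X × p.fst.fiber.space) (ComplementaryPair 𝕜 X) :=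
  ((isBanachManifold_prodAtlas_fiber p.fst).openPartialHomeomorph p.prodChart_mem_prodAtlas).trans
    (isBanachManifold_pairAtlas.openPartialHomeomorph p.pairChart_mem_pairAtlas).symm

variable (p) in
theorem trivialization_source : p.trivialization.source = p.coord.source ×ˢ univ :=
  inter_univ _

variable (p) in
theorem trivialization_target : p.trivialization.target = fst ⁻¹' p.coord.source :=
  inter_eq_left.2 fun _ _ => ⟨mem_univ _, mem_univ _⟩

variable (p) in
theorem isAnalyticOn_trivialization :
    IsAnalyticOn (prodAtlas (grassmannAtlas 𝕜 X) (affineAtlas p.fst.fiber)) (pairAtlas 𝕜 X)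
      p.trivialization p.trivialization.source :=
  isAnalyticOn_chart_trans_symm (isBanachManifold_prodAtlas_fiber p.fst) isBanachManifold_pairAtlas
    p.prodChart_mem_prodAtlas p.pairChart_mem_pairAtlas

variable (p) in
theorem isAnalyticOn_trivialization_symm :
    IsAnalyticOn (pairAtlas 𝕜 X) (prodAtlas (grassmannAtlas 𝕜 X) (affineAtlas p.fst.fiber))
      p.trivialization.symm p.trivialization.target :=
  isAnalyticOn_chart_trans_symm isBanachManifold_pairAtlas (isBanachManifold_prodAtlas_fiber p.fst)
    p.pairChart_mem_pairAtlas p.prodChart_mem_prodAtlas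

variable (p) in
theorem idempotent_trivialization (z : BanachGrassmannian 𝕜 X × p.fst.fiber.space) :
    (p.trivialization z).idempotent.1 = projectionRetraction (p.graphProj (p.coord z.1)) z.2 := by
  have hz : ((p.prodChart z).2 : X →L[𝕜] X) + p.proj = z.2 := sub_add_cancel _ _
  rw [← hz]
  exact p.idempotent_pairChart_symm (p.prodChart z)

theorem trivialization_apply (hE : E ∈ p.coord.source) (A : p.fst.fiber.space) :
    p.trivialization (E, A) = (E.fiberHomeomorph.symm (projectionsOnto.retract
      ⟨p.graphProj (p.coord E), graphProj_coord_mem hE⟩ A.1) : ComplementaryPair 𝕜 X) :=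
  (pairOfProjection_eq (p.idempotent_trivialization (E, A)).symm).symm

theorem exists_affineMap_trivialization (hE : E ∈ p.coord.source) :
    ∃ g : p.fst.fiber.space →ᵃ[𝕜] E.fiber.space,
      ∀ A, p.trivialization (E, A) = (E.fiberHomeomorph.symm (g A) : ComplementaryPair 𝕜 X) :=
  ⟨((projectionsOnto.retract ⟨_, graphProj_coord_mem hE⟩).comp
    p.fst.fiber.space.subtypeA).toAffineMap, trivialization_apply hE⟩

variable (p q) in
/-- The transition map from the trivialization of `p` to that of `q`, over `E`. -/
def transition (E : BanachGrassmannian 𝕜 X) : p.fst.fiber.space →ᴬ[𝕜] q.fst.fiber.space :=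
  (projectionsOnto.retract q.proj).comp
    ((projectionRetraction (p.graphProj (p.coord E))).comp p.fst.fiber.space.subtypeA)

variable (p q) in
theorem transition_apply (E : BanachGrassmannian 𝕜 X) (A : p.fst.fiber.space) :
    transition p q E A = (q.trivialization.symm (p.trivialization (E, A))).2 :=
  congrArg (projectionsOnto.retract q.proj) (p.idempotent_trivialization (E, A)).symm

theorem contLinear_transition : (transition p q E).contLinear =
    projectionsOnto.compress q.proj ∘L ContinuousLinearMap.mulLeftRight 𝕜 (X →L[𝕜] X)
      (p.graphProj (p.coord E)) (1 - p.graphProj (p.coord E)) ∘L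
        p.fst.fiber.space.direction.subtypeL := by
  rw [transition, ContinuousAffineMap.comp_contLinear, ContinuousAffineMap.comp_contLinear,
    projectionsOnto.contLinear_retract, contLinear_projectionRetraction]
  rfl

theorem affineMapCoord_transition_graphMap (A₀ : p.fst.fiber.space) (B₀ : q.fst.fiber.space)
    (T : p.Slope) : affineMapCoord A₀ B₀ (transition p q (p.graphMap T)) =
      (projectionsOnto.compress q.proj (projectionRetraction (p.graphProj T) A₀) + (q.proj -ᵥ B₀),
        projectionsOnto.compress q.proj ∘L ContinuousLinearMap.mulLeftRight 𝕜 (X →L[𝕜] X)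
          (p.graphProj T) (1 - p.graphProj T) ∘L p.fst.fiber.space.direction.subtypeL) := by
  conv_rhs => rw [← p.coord_graphMap T]
  exact Prod.ext (vadd_vsub_assoc _ _ _) contLinear_transition

theorem contDiff_affineMapCoord_transition_graphMap (A₀ : p.fst.fiber.space)
    (B₀ : q.fst.fiber.space) {n : WithTop ℕ∞} :
    ContDiff 𝕜 n fun T => affineMapCoord A₀ B₀ (transition p q (p.graphMap T)) := by
  simp only [affineMapCoord_transition_graphMap, projectionRetraction_apply]
  have hG := p.contDiff_graphProj (n := n)
  have hG' : ContDiff 𝕜 n fun T => 1 - p.graphProj T := contDiff_const.sub hG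
  have hpoint : ContDiff 𝕜 n fun T => p.graphProj T * A₀.1 * (1 - p.graphProj T) + p.graphProj T :=
    ((hG.mul contDiff_const).mul hG').add hG
  have hmul : ContDiff 𝕜 n fun T => ContinuousLinearMap.mulLeftRight 𝕜 (X →L[𝕜] X)
      (p.graphProj T) (1 - p.graphProj T) :=
    contDiff_mulLeftRight hG hG'
  have hlinear : ContDiff 𝕜 n fun T => projectionsOnto.compress q.proj ∘L
      ContinuousLinearMap.mulLeftRight 𝕜 (X →L[𝕜] X) (p.graphProj T) (1 - p.graphProj T) ∘L
        p.fst.fiber.space.direction.subtypeL :=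
    contDiff_const.clm_comp (hmul.clm_comp contDiff_const)
  exact (((projectionsOnto.compress q.proj).contDiff.comp hpoint).add contDiff_const).prodMk hlinear

theorem isAnalyticOn_affineMapCoord_transition (A₀ : p.fst.fiber.space) (B₀ : q.fst.fiber.space) :
    IsAnalyticOn (grassmannAtlas 𝕜 X) (vectorAtlas 𝕜 _)
      (fun E => affineMapCoord A₀ B₀ (transition p q E)) p.coord.source := by
  have hdiff := contDiff_affineMapCoord_transition_graphMap A₀ B₀ (n := ⊤)
  refine .of_exists_charts isBanachManifold_grassmannAtlas (isBanachManifold_vectorAtlas _)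
    (fun E hE => ?_) fun E hE => ⟨_, p.coord_mem_grassmannAtlas, _, rfl, hE, mem_univ _,
      hdiff.contDiffAt.analyticAt⟩
  refine (hdiff.continuous.continuousAt.comp (continuousAt_coord hE)).congr ?_
  filter_upwards [p.isOpen_coord_source.mem_nhds hE] with E' hE'
  rw [Function.comp_apply, graphMap_coord hE']

end ComplementaryPair

open ComplementaryPair in
theorem isAnalyticAffineBanachBundle_fst :
    IsAnalyticAffineBanachBundle (pairAtlas 𝕜 X) (grassmannAtlas 𝕜 X) ComplementaryPair.fst
      (pairFibers 𝕜 X) where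
  total := isBanachManifold_pairAtlas
  base := isBanachManifold_grassmannAtlas
  surjective E := ⟨E.pair, rfl⟩
  analytic := isAnalyticOn_fst
  complete _ := inferInstance
  locallyTrivial := by
    refine ⟨fun E => E.pair.coord.source, fun E => E.pair.trivialization,
      fun E => ⟨E.pair.isOpen_coord_source, E.mem_coord_source, E.pair.trivialization_source,
        E.pair.trivialization_target, E.pair.isAnalyticOn_trivialization,
        E.pair.isAnalyticOn_trivialization_symm, fun _ => exists_affineMap_trivialization⟩,
      fun E E' => ⟨transition E.pair E'.pair, fun D _ => transition_apply E.pair E'.pair D,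
        fun A₀ B₀ => ?_⟩⟩
    exact (isAnalyticOn_affineMapCoord_transition (p := E.pair) (q := E'.pair) A₀ B₀).mono
      inter_subset_left

end Bundle

end

theorem mainTheorem6 {𝕜 : Type u} [RCLike 𝕜] {X : Type v} [NormedAddCommGroup X]
    [NormedSpace 𝕜 X] [CompleteSpace X] :
    IsHomeomorph (ComplementaryPair.idempotent : ComplementaryPair 𝕜 X → Idempotents 𝕜 X) ∧
    ∃ (A : Set (BanachChart.{u, v, v} 𝕜 (ComplementaryPair 𝕜 X)))
      (S : AffineBanachFibers 𝕜 (fun _ : BanachGrassmannian 𝕜 X => X →L[𝕜] X)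
        (ComplementaryPair.fst : ComplementaryPair 𝕜 X → BanachGrassmannian 𝕜 X)),
      IsAnalyticImmersion A (fun p : ComplementaryPair 𝕜 X => (p.idempotent : X →L[𝕜] X)) ∧
      (∀ (E : BanachGrassmannian 𝕜 X) (p : ComplementaryPair 𝕜 X) (hp : p.fst = E),
        (S.homeo E ⟨p, hp⟩ : X →L[𝕜] X) = p.idempotent) ∧
      IsAnalyticAffineBanachBundle A (grassmannAtlas 𝕜 X) ComplementaryPair.fst S :=
  ⟨(ComplementaryPair.idempotentHomeomorph 𝕜 X).isHomeomorph, pairAtlas 𝕜 X, pairFibers 𝕜 X,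
    isAnalyticImmersion_idempotent, fun _ _ _ => rfl, isAnalyticAffineBanachBundle_fst⟩
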